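/- Let $n\ge 1$ and let $\mathbb H^n=\mathbb C^n\times\mathbb R$ be the Heisenberg group with group law $(z,t)(w,s)=\big(z+w,\,t+s+\tfrac12\operatorname{Im}(z\cdot\overline w)\big)$, equipped with Lebesgue measure. Let $\Omega\subset\mathbb R^2$ be the Heisenberg fan, the union of the rays $R_k=\{(\lambda,(2k+n)|\lambda|):\lambda\in\mathbb R\setminus\{0\}\}$, $k=0,1,2,\dots$, and $R_\infty=\{(0,\tau):\tau\ge 0\}$. Put $c_{n,k}=\frac{k!\,(n-1)!}{(k+n-1)!}$ and let $\nu_2$ be the measure on $\Omega$ given by $$\int_\Omega\phi\,d\nu_2=(2\pi)^{-2n-1}\int_{-\infty}^{\infty}\sum_{k=0}^\infty c_{n,k}^{-2}\,\phi\big(\lambda,(2k+n)|\lambda|\big)\,|\lambda|^{2n}\,d\lambda .$$ For $a=(\lambda,(2k+n)|\lambda|)\in R_k$ let $e_a(z,t)=e^{i\lambda t}L_k^{n-1}\big(\tfrac12|\lambda||z|^2\big)e^{-\frac14|\lambda||z|^2}$, where $L_k^{n-1}$ is the Laguerre polynomial of degree $k$ and type $n-1$. For $f\in (L^1\cap L^2)(\mathbb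 H^n)$ the normalized Strichartz Fourier transform of $f$ is $$\mathcal F f(a,w)=c_{n,k}\int_{\mathbb H^n}f(z,t)\,e_a\big((z,t)^{-1}(w,0)\big)\,dz\,dt,\qquad a\in R_k,\ w\in\mathbb C^n,$$ and for $a=(0,\tau)\in R_\infty$ (a $\nu_2$-null set of parameters) it is $\mathcal F f(a,w)=2^{n-1}(n-1)!\int_{\mathbb H^n} f(z,t)\,\frac{J_{n-1}(\sqrt\tau|w-z|)}{(\sqrt\tau|w-z|)^{n-1}}\,dz\,dt$, with $J_{n-1}$ the Bessel function. Let $\mathcal F: L^2(\mathbb H^n)\to L^2(\Omega\times\mathbb C^n,d\nu_2\,dw)$ also denote its extension by continuity to $L^2(\mathbb H^n)$. Let $V\subseteq\mathbb H^n$ and $W\subseteq\Omega$ be measurable sets of finite measure (Lebesgue measure and $\nu_2$, respectively), such that for some $M>0$ $$W\subseteq\{(\lambda,(2k+n)|\lambda|):|\lambda|>M,\ k=0,1,2,\dots\},$$ and let $B\subseteq\mathbb C^n$ be a measurable set of finite Lebesgue measure. Then there is a constant $C>0$ such that for every $f\in L^2(\mathbb H^n)$ $$\|f\|_2^2\le C\Big(\|f\|_{L^2(V^c)}^2+\|\mathcal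 F f\|_{L^2((W\times B)^c)}^2\Big),$$ where the last norm is taken with respect to $d\nu_2\,dw$ on the complement of $W\times B$ in $\Omega\times\mathbb C^n$. -/

import Mathlib

open MeasureTheory Topology
open scoped ENNReal NNReal

noncomputable section

namespace Strichartz

/-- The underlying space `ℂⁿ × ℝ` of the Heisenberg group `ℍⁿ`. Its Haar measure is the Lebesgue
measure `volume`. -/
abbrev Heis (n : ℕ) : Type := (Fin n → ℂ) × ℝ

/-- `z · w̄ = ∑ z_j w̄_j`. -/
def herm {n : ℕ} (z w : Fin n → ℂ) : ℂ := ∑ j, z j * (starRingEnd ℂ) (w j)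

/-- `|z|² = ∑ |z_j|²`, the square of the Euclidean norm. -/
def normSq {n : ℕ} (z : Fin n → ℂ) : ℝ := ∑ j, ‖z j‖ ^ 2

/-- The group law `(z,t)(w,s) = (z + w, t + s + ½ Im (z · w̄))`. -/
def Heis.mul {n : ℕ} (p q : Heis n) : Heis n :=
  (p.1 + q.1, p.2 + q.2 + (1 / 2) * (herm p.1 q.1).im)

/-- The inverse `(z,t)⁻¹ = (-z,-t)` for the Heisenberg group law. -/
def Heis.inv {n : ℕ} (p : Heis n) : Heis n := (-p.1, -p.2)

/-- The Laguerre polynomial `L_k^δ` of degree `k` and (natural number) type `δ`. -/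
def laguerre (δ k : ℕ) (x : ℝ) : ℝ :=
  ∑ i ∈ Finset.range (k + 1),
    (-1) ^ i * (Nat.choose (k + δ) (k - i) : ℝ) * x ^ i / (Nat.factorial i : ℝ)

/-- The Laguerre function `φ_{k,λ}^{n-1}(z) = L_k^{n-1}(½|λ||z|²) e^{-¼|λ||z|²}`. -/
def laguerreFun (n k : ℕ) (l : ℝ) (z : Fin n → ℂ) : ℝ :=
  laguerre (n - 1) k ((1 / 2) * |l| * normSq z) * Real.exp (-((1 / 4) * |l| * normSq z))

/-- The function `x ↦ 2^{n-1} (n-1)! J_{n-1}(x) / x^{n-1}` (with its limiting value `1` at `x = 0`),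
through the power series of the Bessel function `J_{n-1}`. -/
def besselFun (n : ℕ) (x : ℝ) : ℝ :=
  ∑' j : ℕ, (-1) ^ j * (Nat.factorial (n - 1) : ℝ) /
    ((Nat.factorial j : ℝ) * (Nat.factorial (j + (n - 1)) : ℝ)) * (x / 2) ^ (2 * j)

/-- The Heisenberg fan `Ω`: the union of the rays `R_k = {(λ,(2k+n)|λ|) : λ ≠ 0}` and of the
limiting ray `R_∞ = {(0,τ) : τ ≥ 0}`, with the topology and Borel sets inherited from `ℝ²`. -/
def fan (n : ℕ) : Set (ℝ × ℝ) :=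
  {a | (∃ k : ℕ, ∃ l : ℝ, l ≠ 0 ∧ a = (l, (2 * (k : ℝ) + n) * |l|)) ∨
    (∃ τ : ℝ, 0 ≤ τ ∧ a = (0, τ))}

/-- The parametrization `λ ↦ (λ,(2k+n)|λ|)` of the `k`-th ray; `λ = 0` is sent to the origin,
which lies in `R_∞`. -/
def ray (n k : ℕ) (l : ℝ) : fan n :=
  ⟨(l, (2 * (k : ℝ) + n) * |l|), by
    by_cases h : l = 0
    · exact Or.inr ⟨0, le_rfl, by simp [h]⟩
    · exact Or.inl ⟨k, l, h, rfl⟩⟩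

theorem measurable_ray (n k : ℕ) : Measurable (ray n k) := by
  apply Measurable.subtype_mk
  fun_prop

/-- The index `k` of the ray `R_k` on which a point `a = (λ,(2k+n)|λ|)`, `λ ≠ 0`, of the fan lies
(this `k` is unique). -/
def rayIndex {n : ℕ} (a : fan n) : ℕ :=
  sInf {k : ℕ | (a : ℝ × ℝ).2 = (2 * (k : ℝ) + n) * |(a : ℝ × ℝ).1|}

theorem rayIndex_ray (n k : ℕ) {l : ℝ} (hl : l ≠ 0) : rayIndex (ray n k l) = k := by
  have h : {j : ℕ | ((ray n k l : fan n) : ℝ × ℝ).2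
      = (2 * (j : ℝ) + n) * |((ray n k l : fan n) : ℝ × ℝ).1|} = {k} := by
    ext j
    have h0 : |l| ≠ 0 := abs_ne_zero.mpr hl
    simp only [ray, Set.mem_ofPred_eq, Set.mem_singleton_iff]
    constructor
    · intro h
      have h1 := mul_right_cancel₀ h0 h
      have h2 : (j : ℝ) = k := by linarith
      exact_mod_cast h2
    · rintro rfl
      rfl
  rw [rayIndex, h, csInf_singleton]

/-- The constant `c_{n,k} = k! (n-1)! / (k+n-1)!`. -/
def coeff (n k : ℕ) : ℝ :=
  (Nat.factorial k : ℝ) * (Nat.factorial (n - 1) : ℝ) / (Nat.factorial (k + (n - 1)) : ℝ)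

/-- The functions `e_a` on `ℍⁿ`: `e_a(z,t) = e^{iλt} φ_{k,λ}^{n-1}(z)` for
`a = (λ,(2k+n)|λ|) ∈ R_k`, and `e_a(z,t) = 2^{n-1}(n-1)! J_{n-1}(√τ|z|)/(√τ|z|)^{n-1}` for
`a = (0,τ) ∈ R_∞`. -/
def eFun {n : ℕ} (a : fan n) (p : Heis n) : ℂ :=
  if (a : ℝ × ℝ).1 = 0 then
    ((besselFun n (Real.sqrt (a : ℝ × ℝ).2 * Real.sqrt (normSq p.1)) : ℝ) : ℂ)
  else
    Complex.exp (Complex.I * ((a : ℝ × ℝ).1 : ℂ) * (p.2 : ℂ)) *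
      ((laguerreFun n (rayIndex a) (a : ℝ × ℝ).1 p.1 : ℝ) : ℂ)

/-- The normalizing factor: `c_{n,k}` on `R_k` and `1` on `R_∞`. -/
def normFactor {n : ℕ} (a : fan n) : ℝ :=
  if (a : ℝ × ℝ).1 = 0 then 1 else coeff n (rayIndex a)

/-- The normalized Strichartz Fourier transform of an integrable function on `ℍⁿ`,
`(a,w) ↦ c_{n,k} ∫ f(z,t) e_a((z,t)⁻¹(w,0)) dz dt` (with factor `1` instead of `c_{n,k}` on
`R_∞`). -/
def transform {n : ℕ} (f : Heis n → ℂ) (x : fan n × (Fin n → ℂ)) : ℂ :=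
  (normFactor x.1 : ℂ) * ∫ p : Heis n, f p * eFun x.1 (p.inv.mul (x.2, 0))

/-- The measure `ν₂` on the fan:
`∫ φ dν₂ = (2π)^{-2n-1} ∫_ℝ ∑_k c_{n,k}^{-2} φ(λ,(2k+n)|λ|) |λ|^{2n} dλ`. -/
def nu₂ (n : ℕ) : Measure (fan n) :=
  Measure.sum fun k : ℕ =>
    ENNReal.ofReal (((2 * Real.pi) ^ (2 * n + 1))⁻¹ * ((coeff n k) ^ 2)⁻¹) •
      Measure.map (ray n k) (volume.withDensity fun l : ℝ => ENNReal.ofReal (|l| ^ (2 * n)))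

/-- The measure `dν₂(a) dw` on `Ω × ℂⁿ`. -/
abbrev specMeasure (n : ℕ) : Measure (fan n × (Fin n → ℂ)) := (nu₂ n).prod volume

/-- The dense subspace `(L¹ ∩ L²)(ℍⁿ)` of `L²(ℍⁿ)`. -/
def L1L2 (n : ℕ) : Set (Lp ℂ 2 (volume : Measure (Heis n))) :=
  {f | Integrable (f : Heis n → ℂ) volume}

open Classical in
/-- The normalized transform of `f ∈ (L¹ ∩ L²)(ℍⁿ)` as an element of `L²(Ω × ℂⁿ, dν₂ dw)`. By the
Plancherel identity the first case applies to every such `f`. -/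
def transformL1L2 {n : ℕ} (f : Lp ℂ 2 (volume : Measure (Heis n))) :
    Lp ℂ 2 (specMeasure n) :=
  if h : MemLp (transform (f : Heis n → ℂ)) 2 (specMeasure n) then h.toLp else 0

/-- The normalized Strichartz Fourier transform `𝓕 : L²(ℍⁿ) → L²(Ω × ℂⁿ, dν₂ dw)`: the extension
by continuity of the transform from the dense subspace `(L¹ ∩ L²)(ℍⁿ)`. -/
def transformL2 {n : ℕ} :
    Lp ℂ 2 (volume : Measure (Heis n)) → Lp ℂ 2 (specMeasure n) :=
  extendFrom (L1L2 n) transformL1L2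

end Strichartz

end

noncomputable section

namespace Strichartz

/-! ### The generating function of the Laguerre polynomials -/

/-! The inequality is a quantitative form of a vanishing statement, obtained by compactness. If it
failed, there would be unit vectors `u j` whose restriction to `Vᶜ` and whose transform restricted
to `(W ×ˢ B)ᶜ` both tend to zero. The operator f ↦ 1_{W×B} 𝓕(1_V f) is compact: its kernel is
bounded by 1 and V and W×B have finite measure. Since 𝓕 is an isometry, a subsequence of `u j`
converges. Its limit has norm one, lives on V, and has a transform that lives on W×B, so it suffices
that such a function vanishes (`exists_bound_of_seqCompact`, `exists_subseq_tendsto_of_inner`,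
`exists_norm_le_restrict`).

For the vanishing, write f^λ(z) = ∫ f(z,t) e^{-iλt} dt. On the k-th ray the transform is c_{n,k}
times the twisted convolution of f^λ with the Laguerre function φ_k. If λ lies outside the
projection of W to the λ-axis, all these convolutions vanish, hence f^λ = 0 by the Plancherel
formula at fixed λ. The projection has finite length because |λ| > M bounds the density of ν₂ from
below. For almost every z the function t ↦ f(z,t) is therefore supported on a set of finite measure,
and so is its Fourier transform; Benedicks' theorem on the line makes it zero
(`ae_eq_zero_of_support_of_spectrum`, `ae_eq_zero_of_support_finite`).

The Plancherel formula at fixed λ (`hasSum_twConv_norm_sq`) rests on the generating function: ∑ r^k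
φ_k is a Gaussian, and the twisted convolution of the Gaussians of parameters r and s is a multiple
of the one of parameter rs. Comparing power series coefficients gives the reproducing identity of
φ_k. Summing ‖g × φ_k‖² with weights r^k and letting r → 1, where the Gaussian concentrates at the
diagonal, yields ‖g‖² up to the factor (2π/|λ|)^{2n}. -/

theorem pow_mul_laguerre_eq_sum_antidiagonal (δ k : ℕ) (x r : ℝ) :
    r ^ k * laguerre δ k x = ∑ q ∈ Finset.HasAntidiagonal.antidiagonal k,
      ((-x * r) ^ q.1 / (q.1.factorial : ℝ)) *
        (((q.2 + (q.1 + δ)).choose (q.1 + δ) : ℝ) * r ^ q.2) := by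
  rw [Finset.Nat.sum_antidiagonal_eq_sum_range_succ_mk, laguerre, Finset.mul_sum]
  refine Finset.sum_congr rfl fun i hi => ?_
  have hik : i ≤ k := Nat.lt_succ_iff.mp (Finset.mem_range.mp hi)
  have h1 : (k - i + (i + δ)).choose (i + δ) = (k + δ).choose (k - i) := by
    rw [show k - i + (i + δ) = k + δ by omega]
    exact (Nat.choose_symm_of_eq_add (by omega))
  simp only [h1]
  rw [← pow_sub_mul_pow r hik, mul_pow, neg_pow]
  ring

/-- The double series with terms (-xr)^i/i! · C(m+i+δ, i+δ) r^m is summed in two ways. Over m it is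
a negative binomial series and then over i an exponential series; along the antidiagonals i + m = k
it gives r^k L_k. Taking absolute values of the terms produces the same double series at |xr| and
|r|, whence absolute convergence. -/
theorem hasSum_laguerre (δ : ℕ) (x : ℝ) {r : ℝ} (hr : |r| < 1) :
    HasSum (fun k => r ^ k * laguerre δ k x)
      (((1 - r) ^ (δ + 1))⁻¹ * Real.exp (-(x * r / (1 - r)))) := by
  let u : ℝ → ℝ → ℕ × ℕ → ℝ := fun y r q => (y ^ q.1 / (q.1.factorial : ℝ)) *
        (((q.2 + (q.1 + δ)).choose (q.1 + δ) : ℝ) * r ^ q.2)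
  have hin : ∀ y r : ℝ, |r| < 1 → ∀ i, HasSum (fun m => u y r (i, m))
      ((y ^ i / (i.factorial : ℝ)) * (1 / (1 - r) ^ (i + δ + 1))) := fun y r hr i =>
    (hasSum_choose_mul_geometric_of_norm_lt_one (i + δ) (r := r) (by simpa using hr)).mul_left _
  have hout : ∀ y r : ℝ, |r| < 1 →
      HasSum (fun i : ℕ => (y ^ i / (i.factorial : ℝ)) * (1 / (1 - r) ^ (i + δ + 1)))
        (((1 - r) ^ (δ + 1))⁻¹ * Real.exp (y / (1 - r))) := fun y r hr => by
    have h1 : 1 - r ≠ 0 := by linarith [(abs_lt.mp hr).2]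
    have := (NormedSpace.expSeries_div_hasSum_exp (y / (1 - r))).mul_left ((1 - r) ^ (δ + 1))⁻¹
    rw [← Real.exp_eq_exp_ℝ] at this
    refine this.congr_fun fun i => ?_
    rw [add_assoc, pow_add, div_pow]
    field_simp
  have habs : ∀ q, ‖u (-x * r) r q‖ = u |-x * r| |r| q := fun q => by
    simp [u, abs_mul]
  have hsum : Summable (u (-x * r) r) := by
    refine Summable.of_norm ?_
    simp_rw [habs]
    rw [summable_prod_of_nonneg (fun q => by simp only [u]; positivity)]
    have hr' : |(|r|)| < 1 := by simpa using hr
    refine ⟨fun i => (hin _ _ hr' i).summable, ?_⟩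
    simp_rw [(hin _ _ hr' _).tsum_eq]
    exact (hout _ _ hr').summable
  have htot : HasSum (u (-x * r) r)
      (((1 - r) ^ (δ + 1))⁻¹ * Real.exp (-(x * r / (1 - r)))) := by
    have h2 := hsum.hasSum.prod_fiberwise (hin (-x * r) r hr)
    have h3 := h2.unique (hout _ _ hr)
    have h4 := hsum.hasSum
    rw [h3] at h4
    convert h4 using 3
    ring
  rw [← Finset.HasAntidiagonal.sigmaAntidiagonalEquivProd.hasSum_iff] at htot
  refine (htot.sigma fun k => hasSum_fintype _).congr_fun fun k => ?_
  rw [pow_mul_laguerre_eq_sum_antidiagonal, ← Finset.sum_coe_sort]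
  rfl

theorem abs_laguerre_le (δ k : ℕ) {x : ℝ} (hx : 0 ≤ x) :
    |laguerre δ k x| ≤ laguerre δ k (-x) := by
  unfold laguerre
  refine (Finset.abs_sum_le_sum_abs _ _).trans (Finset.sum_le_sum fun i _ => ?_)
  rw [neg_pow x, abs_div, abs_mul, abs_mul, abs_pow, abs_neg, abs_one, one_pow, one_mul]
  simp only [Nat.abs_cast, abs_pow, abs_of_nonneg hx]
  have : ((-1 : ℝ) ^ i * (-1) ^ i) = 1 := by rw [← mul_pow]; simp
  apply le_of_eq
  calc _ = ((-1 : ℝ) ^ i * (-1) ^ i) * (((k + δ).choose (k - i) : ℝ) * x ^ i / i.factorial) := by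
        rw [this, one_mul]
    _ = _ := by ring

/-- At a negative argument all terms of the generating series are nonnegative, so each is at most
the sum. The choice r = 1/5 makes the exponent x/4; with x = |λ||z|²/2 it uses up only half of the
decay e^{-|λ||z|²/4}, so a Gaussian remains. The price is the factor 5^k. -/
theorem laguerre_neg_le (δ k : ℕ) {x : ℝ} (hx : 0 ≤ x) :
    laguerre δ k (-x) ≤ 5 ^ k * ((5 / 4) ^ (δ + 1) * Real.exp (x / 4)) := by
  have h := hasSum_laguerre δ (-x) (r := 1 / 5) (by norm_num [abs_of_pos])
  have h1 := le_hasSum h k fun j _ =>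
    mul_nonneg (by positivity) ((abs_nonneg _).trans (abs_laguerre_le δ j hx))
  have e1 : ((1 - 1 / 5 : ℝ) ^ (δ + 1))⁻¹ = (5 / 4) ^ (δ + 1) := by
    rw [← inv_pow]; norm_num
  have e2 : -(-x * (1 / 5) / (1 - 1 / 5)) = x / 4 := by ring
  rw [e1, e2] at h1
  calc laguerre δ k (-x) = 5 ^ k * ((1 / 5) ^ k * laguerre δ k (-x)) := by
        rw [← mul_assoc, ← mul_pow]; norm_num
    _ ≤ _ := by gcongr

theorem laguerre_zero (δ k : ℕ) : laguerre δ k 0 = ((k + δ).choose k : ℝ) := by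
  unfold laguerre
  rw [Finset.sum_eq_single 0]
  · simp
  · intro i _ hi; simp [hi]
  · simp

theorem normSq_nonneg {n : ℕ} (z : Fin n → ℂ) : 0 ≤ normSq z :=
  Finset.sum_nonneg fun _ _ => by positivity

theorem normSq_neg {n : ℕ} (z : Fin n → ℂ) : normSq (-z) = normSq z := by simp [normSq]

@[simp] theorem normSq_zero {n : ℕ} : normSq (0 : Fin n → ℂ) = 0 := by simp [normSq]

@[fun_prop]
theorem continuous_normSq {n : ℕ} : Continuous (normSq : (Fin n → ℂ) → ℝ) := by
  unfold normSq; fun_prop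

@[fun_prop]
theorem continuous_laguerre (δ k : ℕ) : Continuous (laguerre δ k) := by
  unfold laguerre; fun_prop

@[fun_prop]
theorem continuous_laguerreFun (n k : ℕ) (l : ℝ) : Continuous (laguerreFun n k l) := by
  unfold laguerreFun; fun_prop

theorem abs_laguerreFun_le_gaussian {n : ℕ} (hn : 1 ≤ n) (k : ℕ) (l : ℝ) (z : Fin n → ℂ) :
    |laguerreFun n k l z| ≤ 5 ^ k * ((5 / 4) ^ n * Real.exp (-(|l| / 8 * normSq z))) := by
  have hx : 0 ≤ (1 / 2) * |l| * normSq z := by have := normSq_nonneg z; positivity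
  have h := (abs_laguerre_le (n - 1) k hx).trans (laguerre_neg_le (n - 1) k hx)
  rw [laguerreFun, abs_mul, Real.abs_exp]
  calc _ ≤ 5 ^ k * ((5 / 4) ^ (n - 1 + 1) * Real.exp ((1 / 2) * |l| * normSq z / 4)) *
        Real.exp (-((1 / 4) * |l| * normSq z)) := by gcongr
    _ = _ := by
      rw [Nat.sub_add_cancel hn, mul_assoc, mul_assoc, ← Real.exp_add]
      ring_nf

theorem hasSum_laguerreFun {n : ℕ} (hn : 1 ≤ n) (l : ℝ) (z : Fin n → ℂ) {r : ℝ} (hr : |r| < 1) :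
    HasSum (fun k => r ^ k * laguerreFun n k l z)
      (((1 - r) ^ n)⁻¹ * Real.exp (-(|l| / 4 * ((1 + r) / (1 - r)) * normSq z))) := by
  have h1 : 1 - r ≠ 0 := by linarith [(abs_lt.mp hr).2]
  have h := (hasSum_laguerre (n - 1) ((1 / 2) * |l| * normSq z) hr).mul_right
    (Real.exp (-((1 / 4) * |l| * normSq z)))
  rw [Nat.sub_add_cancel hn, mul_assoc _ (Real.exp _), ← Real.exp_add] at h
  have e : |l| / 4 * ((1 + r) / (1 - r)) * normSq z
      = (1 / 2) * |l| * normSq z * r / (1 - r) + (1 / 4) * |l| * normSq z := by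
    field_simp
    ring
  rw [e, neg_add]
  refine h.congr_fun fun k => ?_
  rw [laguerreFun]; ring

/-! ### Twisted convolution of Gaussians -/

/-- In real coordinates the integrand is a product of two one-dimensional Gaussians with complex
linear terms; completing the squares gives the result. -/
theorem integral_twisted_gaussian_one {a b : ℝ} (hab : 0 < a + b) (l : ℝ) (z z' : ℂ) :
    ∫ w : ℂ, Complex.exp (-(Complex.I * l * ((1 / 2 * (z * (starRingEnd ℂ) w).im : ℝ) : ℂ))
        + Complex.I * l * ((1 / 2 * (z' * (starRingEnd ℂ) w).im : ℝ) : ℂ)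
        - (a * ‖w - z‖ ^ 2 + b * ‖w - z'‖ ^ 2 : ℝ)) =
      ((Real.pi / (a + b) : ℝ) : ℂ) *
        Complex.exp (-(Complex.I * l * ((1 / 2 * (z * (starRingEnd ℂ) z').im : ℝ) : ℂ))
          - ((a * b + l ^ 2 / 16) / (a + b) * ‖z' - z‖ ^ 2 : ℝ)) := by
  obtain ⟨x, y⟩ := z
  obtain ⟨x', y'⟩ := z'
  rw [← Complex.volume_preserving_equiv_real_prod.symm.integral_comp
    (Complex.measurableEquivRealProd.symm.measurableEmbedding)]
  have hre : (-((a + b : ℝ) : ℂ)).re < 0 := by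
    rw [Complex.neg_re, Complex.ofReal_re]; linarith
  have hsplit : ∀ p : ℝ × ℝ,
      Complex.exp (-(Complex.I * l * ((1 / 2 * ((⟨x, y⟩ : ℂ) *
          (starRingEnd ℂ) (Complex.measurableEquivRealProd.symm p)).im : ℝ) : ℂ))
        + Complex.I * l * ((1 / 2 * ((⟨x', y'⟩ : ℂ) *
          (starRingEnd ℂ) (Complex.measurableEquivRealProd.symm p)).im : ℝ) : ℂ)
        - (a * ‖Complex.measurableEquivRealProd.symm p - ⟨x, y⟩‖ ^ 2
          + b * ‖Complex.measurableEquivRealProd.symm p - ⟨x', y'⟩‖ ^ 2 : ℝ)) =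
      Complex.exp (-((a + b : ℝ) : ℂ) * (p.1 : ℂ) ^ 2 +
          (2 * a * x + 2 * b * x' - Complex.I * l / 2 * (y - y')) * p.1 + (-(a * x ^ 2 + b *
              x' ^ 2)))
        * Complex.exp (-((a + b : ℝ) : ℂ) * (p.2 : ℂ) ^ 2 +
          (2 * a * y + 2 * b * y' + Complex.I * l / 2 * (x - x')) * p.2
            + (-(a * y ^ 2 + b * y' ^ 2))) := by
    rintro ⟨s, t⟩
    rw [← Complex.exp_add]
    congr 1
    have e : Complex.measurableEquivRealProd.symm (s, t) = (⟨s, t⟩ : ℂ) := rfl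
    rw [e, ← Complex.normSq_eq_norm_sq, ← Complex.normSq_eq_norm_sq]
    simp only [Complex.normSq_apply, Complex.mul_im, Complex.conj_re, Complex.conj_im,
      Complex.sub_re, Complex.sub_im]
    push_cast
    ring
  simp_rw [hsplit]
  rw [Measure.volume_eq_prod, integral_prod_mul
    (fun s : ℝ => Complex.exp (-((a + b : ℝ) : ℂ) * (s : ℂ) ^ 2 +
          (2 * a * x + 2 * b * x' - Complex.I * l / 2 * (y - y')) * s + (-(a * x ^ 2 + b *
              x' ^ 2))))
    (fun t : ℝ => Complex.exp (-((a + b : ℝ) : ℂ) * (t : ℂ) ^ 2 +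
          (2 * a * y + 2 * b * y' + Complex.I * l / 2 * (x - x')) * t
            + (-(a * y ^ 2 + b * y' ^ 2)))), integral_cexp_quadratic hre,
    integral_cexp_quadratic hre]
  have hp : (Real.pi / -(-((a + b : ℝ) : ℂ)) : ℂ) = ((Real.pi / (a + b) : ℝ) : ℂ) := by
    push_cast; rw [neg_neg]
  rw [hp]
  have hpos : 0 < Real.pi / (a + b) := by positivity
  have hne : (((Real.pi / (a + b) : ℝ) : ℂ)) ≠ 0 := by exact_mod_cast hpos.ne'
  rw [mul_mul_mul_comm, ← Complex.cpow_add _ _ hne, ← Complex.exp_add]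
  norm_num
  left
  have hab' : ((a : ℂ) + b) ≠ 0 := by exact_mod_cast hab.ne'
  have e2 : ∀ u v : ℝ, (‖(⟨u, v⟩ : ℂ)‖ : ℂ) ^ 2 = (u : ℂ) ^ 2 + (v : ℂ) ^ 2 := fun u v => by
    rw [← Complex.ofReal_pow, ← Complex.normSq_eq_norm_sq]
    simp [Complex.normSq_apply]; ring
  have e3 : (⟨x', y'⟩ : ℂ) - ⟨x, y⟩ = ⟨x' - x, y' - y⟩ := by apply Complex.ext <;> simp
  rw [e3, e2]
  push_cast
  congr 1
  have hba : -(b : ℂ) + -(a : ℂ) = -((a : ℂ) + b) := by ring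
  rw [hba]
  field_simp
  ring_nf
  simp only [Complex.I_sq]
  ring

/-- The unimodular factor `e^{-(i/2) λ Im (z · w̄)}` of the `λ`-twisted convolution. -/
def phase {n : ℕ} (l : ℝ) (z w : Fin n → ℂ) : ℂ :=
  Complex.exp (-(Complex.I * l * ((1 / 2 * (herm z w).im : ℝ) : ℂ)))

/-- The kernel of the twisted convolution with `∑_k r^k φ_{k,λ}^{n-1}`. -/
def gaussKernel {n : ℕ} (l r : ℝ) (z w : Fin n → ℂ) : ℂ :=
  phase l z w * ((((1 - r) ^ n)⁻¹ *
    Real.exp (-(|l| / 4 * ((1 + r) / (1 - r)) * normSq (w - z))) : ℝ) : ℂ)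

/-- The kernel of the twisted convolution with `φ_{k,λ}^{n-1}`. -/
def lagKernel {n : ℕ} (k : ℕ) (l : ℝ) (z w : Fin n → ℂ) : ℂ :=
  phase l z w * (laguerreFun n k l (w - z) : ℂ)

theorem norm_phase {n : ℕ} (l : ℝ) (z w : Fin n → ℂ) : ‖phase l z w‖ = 1 := by
  rw [phase, show -(Complex.I * l * ((1 / 2 * (herm z w).im : ℝ) : ℂ))
    = ((-(l * (1 / 2 * (herm z w).im)) : ℝ) : ℂ) * Complex.I by push_cast; ring]
  exact Complex.norm_exp_ofReal_mul_I _

theorem continuous_herm {n : ℕ} :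
    Continuous fun p : (Fin n → ℂ) × (Fin n → ℂ) => herm p.1 p.2 := by
  unfold herm; fun_prop

theorem continuous_phase {n : ℕ} (l : ℝ) :
    Continuous fun p : (Fin n → ℂ) × (Fin n → ℂ) => phase l p.1 p.2 := by
  have := continuous_herm (n := n)
  unfold phase; fun_prop

theorem continuous_gaussKernel {n : ℕ} (l r : ℝ) :
    Continuous fun p : (Fin n → ℂ) × (Fin n → ℂ) => gaussKernel l r p.1 p.2 := by
  have := continuous_phase (n := n) l
  unfold gaussKernel; fun_prop

theorem continuous_lagKernel {n : ℕ} (k : ℕ) (l : ℝ) :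
    Continuous fun p : (Fin n → ℂ) × (Fin n → ℂ) => lagKernel k l p.1 p.2 := by
  have := continuous_phase (n := n) l
  unfold lagKernel; fun_prop

theorem conj_phase {n : ℕ} (l : ℝ) (z w : Fin n → ℂ) :
    (starRingEnd ℂ) (phase l z w) =
      Complex.exp (Complex.I * l * ((1 / 2 * (herm z w).im : ℝ) : ℂ)) := by
  rw [phase, ← Complex.exp_conj]
  congr 1
  simp only [map_neg, map_mul, Complex.conj_I, Complex.conj_ofReal]
  ring

theorem norm_gaussKernel_le {n : ℕ} {l r : ℝ} (hr : |r| < 1) (z w : Fin n → ℂ) :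
    ‖gaussKernel l r z w‖ ≤ ((1 - r) ^ n)⁻¹ := by
  obtain ⟨h1, h2⟩ := abs_lt.mp hr
  have h3 : 0 < 1 - r := by linarith
  have h4 : 0 < 1 + r := by linarith
  have := normSq_nonneg (w - z)
  rw [gaussKernel, norm_mul, norm_phase, one_mul, Complex.norm_real, Real.norm_of_nonneg
    (by positivity)]
  refine mul_le_of_le_one_right (by positivity) (Real.exp_le_one_iff.mpr ?_)
  have : 0 ≤ |l| / 4 * ((1 + r) / (1 - r)) * normSq (w - z) := by positivity
  linarith

/-- The integral factors over the coordinates of ℂⁿ. The parameters multiply because (1+r)/(1-r) is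
coth x for r = e^{-2x}: the new exponent is the addition formula for coth, written in a form that
also covers r ≤ 0. -/
theorem integral_gaussKernel_mul_conj {n : ℕ} {l r s : ℝ} (hl : l ≠ 0) (hr : |r| < 1)
    (hs : |s| < 1) (z z' : Fin n → ℂ) :
    ∫ w, gaussKernel l r z w * (starRingEnd ℂ) (gaussKernel l s z' w) =
      (((2 * Real.pi / |l|) ^ n : ℝ) : ℂ) * gaussKernel l (r * s) z z' := by
  obtain ⟨hr1, hr2⟩ := abs_lt.mp hr
  obtain ⟨hs1, hs2⟩ := abs_lt.mp hs
  have hr3 : 0 < 1 - r := by linarith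
  have hs3 : 0 < 1 - s := by linarith
  have hr4 : 0 < 1 + r := by linarith
  have hs4 : 0 < 1 + s := by linarith
  have hl' : 0 < |l| := abs_pos.mpr hl
  have hrs : 0 < 1 - r * s := by nlinarith
  set a := |l| / 4 * ((1 + r) / (1 - r)) with ha
  set b := |l| / 4 * ((1 + s) / (1 - s)) with hb
  have hab : 0 < a + b := by positivity
  have h1 : ∀ w, gaussKernel l r z w * (starRingEnd ℂ) (gaussKernel l s z' w) =
      ((((1 - r) ^ n)⁻¹ * ((1 - s) ^ n)⁻¹ : ℝ) : ℂ) * ∏ j,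
        Complex.exp (-(Complex.I * l * ((1 / 2 * (z j * (starRingEnd ℂ) (w j)).im : ℝ) : ℂ))
        + Complex.I * l * ((1 / 2 * (z' j * (starRingEnd ℂ) (w j)).im : ℝ) : ℂ)
        - (a * ‖w j - z j‖ ^ 2 + b * ‖w j - z' j‖ ^ 2 : ℝ)) := by
    intro w
    rw [gaussKernel, gaussKernel, map_mul, conj_phase, Complex.conj_ofReal, phase,
      ← Complex.exp_sum, Complex.ofReal_mul ((1 - r) ^ n)⁻¹, Complex.ofReal_mul ((1 - s) ^ n)⁻¹,
      Complex.ofReal_exp, Complex.ofReal_exp, Complex.ofReal_mul ((1 - r) ^ n)⁻¹]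
    have e : ∀ A B C D E F : ℂ, A * (B * C) * (D * (E * F)) = (B * E) * (A * C * D * F) := by
      intros; ring
    rw [e, ← Complex.exp_add, ← Complex.exp_add, ← Complex.exp_add]
    congr 2
    simp only [herm, normSq, Complex.im_sum, Finset.sum_add_distrib, Finset.sum_sub_distrib,
      Finset.mul_sum, Complex.ofReal_sum, Pi.sub_apply, Finset.sum_neg_distrib, Complex.ofReal_neg,
      Complex.ofReal_add]
    ring
  simp_rw [h1]
  rw [integral_const_mul, integral_fintype_prod_volume_eq_prod (fun j w =>
      Complex.exp (-(Complex.I * l * ((1 / 2 * (z j * (starRingEnd ℂ) w).im : ℝ) : ℂ))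
        + Complex.I * l * ((1 / 2 * (z' j * (starRingEnd ℂ) w).im : ℝ) : ℂ)
        - (a * ‖w - z j‖ ^ 2 + b * ‖w - z' j‖ ^ 2 : ℝ)))]
  simp_rw [integral_twisted_gaussian_one hab]
  rw [Finset.prod_mul_distrib, ← Complex.exp_sum, Finset.prod_const, Finset.card_univ,
    Fintype.card_fin, gaussKernel, phase]
  have e1 : Real.pi / (a + b) = 2 * Real.pi / |l| * ((1 - r) * (1 - s) / (1 - r * s)) := by
    rw [ha, hb]; field_simp; ring
  have e2 : (a * b + l ^ 2 / 16) / (a + b) = |l| / 4 * ((1 + r * s) / (1 - r * s)) := by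
    rw [ha, hb, ← sq_abs l]; field_simp; ring
  rw [e1, e2, Complex.ofReal_mul ((1 - r * s) ^ n)⁻¹, Complex.ofReal_exp]
  have e : ∀ A C D E : ℂ, A * (C * (D * E)) = A * D * (C * E) := by intros; ring
  rw [e, ← Complex.exp_add, ← mul_assoc]
  congr 1
  · rw [← Complex.ofReal_pow, ← Complex.ofReal_mul, ← Complex.ofReal_mul]
    congr 1
    rw [mul_pow, div_pow ((1 - r) * (1 - s)), mul_pow (1 - r)]
    field_simp
  · congr 1
    simp only [herm, normSq, Complex.im_sum, Finset.sum_sub_distrib,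
      Finset.mul_sum, Complex.ofReal_sum, Pi.sub_apply, Finset.sum_neg_distrib, Complex.ofReal_neg]
    ring

theorem gaussian_eq_prod {n : ℕ} (c : ℝ) (z : Fin n → ℂ) :
    Real.exp (-(c * normSq z)) = ∏ j, Real.exp (-c * ‖z j‖ ^ 2) := by
  rw [← Real.exp_sum, normSq, Finset.mul_sum, ← Finset.sum_neg_distrib]
  simp only [neg_mul]

theorem integrable_gaussian_normSq {n : ℕ} {c : ℝ} (hc : 0 < c) :
    Integrable fun z : Fin n → ℂ => Real.exp (-(c * normSq z)) := by
  simp_rw [gaussian_eq_prod]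
  refine Integrable.fintype_prod (f := fun _ (w : ℂ) => Real.exp (-c * ‖w‖ ^ 2)) fun j => ?_
  have h := GaussianFourier.integral_rexp_neg_mul_sq_norm (V := ℂ) hc
  by_contra H
  rw [integral_undef H] at h
  have : 0 < (Real.pi / c) ^ (Module.finrank ℝ ℂ / 2 : ℝ) := by positivity
  exact this.ne h

theorem integral_gaussian_normSq {n : ℕ} {c : ℝ} (hc : 0 < c) :
    ∫ z : Fin n → ℂ, Real.exp (-(c * normSq z)) = (Real.pi / c) ^ n := by
  simp_rw [gaussian_eq_prod]
  rw [integral_fintype_prod_volume_eq_prod (fun _ (w : ℂ) => Real.exp (-c * ‖w‖ ^ 2))]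
  rw [Finset.prod_const, GaussianFourier.integral_rexp_neg_mul_sq_norm (V := ℂ) hc]
  simp

/-! ### Orthogonality of the Laguerre kernels -/

/-- Uniqueness of power series coefficients from values at small real arguments. It turns Gaussian
identities into identities for the individual Laguerre functions. -/
theorem eq_of_hasSum_pow_mul {a b : ℕ → ℂ} {ε : ℝ} (hε : 0 < ε) {S : ℝ → ℂ}
    (ha : ∀ r : ℝ, |r| < ε → HasSum (fun k => (r : ℂ) ^ k * a k) (S r))
    (hb : ∀ r : ℝ, |r| < ε → HasSum (fun k => (r : ℂ) ^ k * b k) (S r)) : a = b := by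
  have hd : ∀ r : ℝ, |r| < ε → HasSum (fun k => (r : ℂ) ^ k * (a k - b k)) 0 := fun r hr => by
    have := (ha r hr).sub (hb r hr)
    rw [sub_self] at this
    exact this.congr_fun fun k => mul_sub _ _ _
  let p : FormalMultilinearSeries ℝ ℝ ℂ := fun k =>
    ContinuousMultilinearMap.mkPiRing ℝ (Fin k) (a k - b k)
  -- Convergence at the single point ε/2 makes the terms there tend to zero, which bounds the radius
  -- of convergence from below.
  have hε2 : |ε / 2| < ε := by rw [abs_of_pos (by linarith)]; linarith
  have hε3 : (0 : ℝ) ≤ ε / 2 := by linarith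
  have hball : HasFPowerSeriesOnBall (0 : ℝ → ℂ) p 0 (ENNReal.ofReal (ε / 2)) := by
    refine ⟨?_, by simpa using hε, fun {y} hy => ?_⟩
    · have ht := (hd _ hε2).summable.tendsto_atTop_zero
      refine p.le_radius_of_tendsto (r := (ε / 2).toNNReal) (l := 0) ?_
      have := ht.norm
      simp only [norm_zero] at this
      refine this.congr fun k => ?_
      simp only [p, ContinuousMultilinearMap.norm_mkPiRing, norm_mul, norm_pow,
        Complex.norm_real, Real.norm_of_nonneg hε3, Real.coe_toNNReal _ hε3]
      rw [mul_comm]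
    · rw [Metric.eball_ofReal, Metric.mem_ball, dist_zero_right, Real.norm_eq_abs] at hy
      refine (hd y (by linarith)).congr_fun fun k => ?_
      simp [p]
  have hp := hball.hasFPowerSeriesAt.eq_zero
  ext k
  have h1 : p k = 0 := by rw [hp]; rfl
  have h2 := congrArg (fun m => m fun _ => (1 : ℝ)) h1
  simp [p] at h2
  exact sub_eq_zero.mp h2

variable {n : ℕ}

theorem continuous_lagKernel_right (k : ℕ) (l : ℝ) (z : Fin n → ℂ) :
    Continuous fun w => lagKernel k l z w := by
  have := (continuous_lagKernel (n := n) k l).comp (Continuous.prodMk_right z)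
  exact this

theorem continuous_gaussKernel_right (l r : ℝ) (z : Fin n → ℂ) :
    Continuous fun w => gaussKernel l r z w := by
  have := (continuous_gaussKernel (n := n) l r).comp (Continuous.prodMk_right z)
  exact this

theorem norm_lagKernel_le (hn : 1 ≤ n) (k : ℕ) (l : ℝ) (z w : Fin n → ℂ) :
    ‖lagKernel k l z w‖ ≤ 5 ^ k * ((5 / 4) ^ n * Real.exp (-(|l| / 8 * normSq (w - z)))) := by
  rw [lagKernel, norm_mul, norm_phase, one_mul, Complex.norm_real]
  exact abs_laguerreFun_le_gaussian hn k l _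

theorem hasSum_lagKernel (hn : 1 ≤ n) (l : ℝ) (z w : Fin n → ℂ) {r : ℝ} (hr : |r| < 1) :
    HasSum (fun k => (r : ℂ) ^ k * lagKernel k l z w) (gaussKernel l r z w) := by
  have h := (Complex.hasSum_ofReal.mpr (hasSum_laguerreFun hn l (w - z) hr)).mul_left (phase l z w)
  refine h.congr_fun fun k => ?_
  rw [lagKernel]
  push_cast
  ring

theorem integrable_gaussian_sub {c : ℝ} (hc : 0 < c) (z : Fin n → ℂ) :
    Integrable fun w : Fin n → ℂ => Real.exp (-(c * normSq (w - z))) :=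
  (integrable_gaussian_normSq hc).comp_sub_right z

theorem integrable_lagKernel_mul (hn : 1 ≤ n) {l : ℝ} (hl : l ≠ 0) (k : ℕ) (z : Fin n → ℂ)
    {H : (Fin n → ℂ) → ℂ} (hH : Continuous H) {C : ℝ} (hC : ∀ w, ‖H w‖ ≤ C) :
    Integrable fun w => lagKernel k l z w * H w := by
  have hl' : 0 < |l| / 8 := by positivity
  refine (((integrable_gaussian_sub hl' z).const_mul ((5 / 4) ^ n)).const_mul
    (5 ^ k)).mul_const C |>.mono' ?_ (ae_of_all _ fun w => ?_)
  · exact ((continuous_lagKernel_right k l z).mul hH).aestronglyMeasurable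
  · rw [norm_mul]
    exact mul_le_mul (norm_lagKernel_le hn k l z w) (hC w) (norm_nonneg _) (by positivity)

/-- The restriction |r| < 1/10 beats the factor 5^k of the crude Gaussian bound, leaving (1/2)^k; a
neighbourhood of r = 0 is enough for comparing coefficients. -/
theorem hasSum_integral_lagKernel_mul (hn : 1 ≤ n) {l : ℝ} (hl : l ≠ 0) (z : Fin n → ℂ)
    {H : (Fin n → ℂ) → ℂ} (hH : Continuous H) {C : ℝ} (hC : ∀ w, ‖H w‖ ≤ C) {r : ℝ}
    (hr : |r| < 1 / 10) :
    HasSum (fun k => (r : ℂ) ^ k * ∫ w, lagKernel k l z w * H w)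
      (∫ w, gaussKernel l r z w * H w) := by
  have hl' : 0 < |l| / 8 := by positivity
  have hi := fun k => integrable_lagKernel_mul hn hl k z hH hC
  have hC0 : 0 ≤ C := (norm_nonneg _).trans (hC 0)
  have hs : Summable fun k => ∫ w, ‖(r : ℂ) ^ k * (lagKernel k l z w * H w)‖ := by
    set D := ∫ w : Fin n → ℂ, (5 / 4) ^ n * Real.exp (-(|l| / 8 * normSq (w - z))) * C with hD
    have hD0 : 0 ≤ D := integral_nonneg fun w => by positivity
    refine Summable.of_nonneg_of_le (fun k => integral_nonneg fun w => norm_nonneg _)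
      (fun k => ?_) ((summable_geometric_of_lt_one (by norm_num : (0 : ℝ) ≤ 1 / 2)
        (by norm_num)).mul_right D)
    rw [hD, ← integral_const_mul]
    refine integral_mono ((hi k).const_mul _).norm
      ((((integrable_gaussian_sub hl' z).const_mul _).mul_const C).const_mul _) fun w => ?_
    simp only [norm_mul, norm_pow, Complex.norm_real, Real.norm_eq_abs]
    calc |r| ^ k * (‖lagKernel k l z w‖ * ‖H w‖)
        ≤ (1 / 10) ^ k * ((5 ^ k * ((5 / 4) ^ n * Real.exp (-(|l| / 8 * normSq (w - z))))) * C) :=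
            by
          gcongr
          · exact norm_lagKernel_le hn k l z w
          · exact hC w
      _ = (1 / 2) ^ k * ((5 / 4) ^ n * Real.exp (-(|l| / 8 * normSq (w - z))) * C) := by
          rw [show (1 / 2 : ℝ) = 1 / 10 * 5 by norm_num, mul_pow]; ring
  have h := hasSum_integral_of_summable_integral_norm
    (F := fun k w => (r : ℂ) ^ k * (lagKernel k l z w * H w)) (fun k => (hi k).const_mul _) hs
  have e : ∀ w, ∑' k, (r : ℂ) ^ k * (lagKernel k l z w * H w) = gaussKernel l r z w * H w := by
    intro w
    have := ((hasSum_lagKernel hn l z w (r := r) (by linarith)).mul_right (H w)).tsum_eq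
    simpa only [mul_assoc] using this
  simp_rw [e] at h
  exact h.congr_fun fun k => (integral_const_mul _ _).symm

/-- Coefficient of r^k in the product formula for the Gaussian kernels, with s kept fixed. -/
theorem integral_lagKernel_mul_conj_gaussKernel (hn : 1 ≤ n) {l : ℝ} (hl : l ≠ 0) (k : ℕ)
    (z z' : Fin n → ℂ) {s : ℝ} (hs : |s| < 1) :
    ∫ w, lagKernel k l z w * (starRingEnd ℂ) (gaussKernel l s z' w) =
      (((2 * Real.pi / |l|) ^ n : ℝ) : ℂ) * ((s : ℂ) ^ k * lagKernel k l z z') := by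
  have hcont : Continuous fun w => (starRingEnd ℂ) (gaussKernel l s z' w) :=
    Complex.continuous_conj.comp (continuous_gaussKernel_right l s z')
  refine congrFun (eq_of_hasSum_pow_mul
    (a := fun k => ∫ w, lagKernel k l z w * (starRingEnd ℂ) (gaussKernel l s z' w))
    (b := fun k => (((2 * Real.pi / |l|) ^ n : ℝ) : ℂ) * ((s : ℂ) ^ k * lagKernel k l z z'))
    (S := fun r => (((2 * Real.pi / |l|) ^ n : ℝ) : ℂ) * gaussKernel l (r * s) z z')
    (show (0 : ℝ) < 1 / 10 by norm_num) (fun r hr => ?_) (fun r hr => ?_)) k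
  · have := hasSum_integral_lagKernel_mul hn hl z hcont (C := ((1 - s) ^ n)⁻¹)
      (fun w => by rw [RCLike.norm_conj]; exact norm_gaussKernel_le hs z' w) hr
    rwa [integral_gaussKernel_mul_conj hl (by linarith) hs] at this
  · have hrs : |r * s| < 1 := by
      rw [abs_mul]; nlinarith [abs_nonneg r, abs_nonneg s]
    refine ((hasSum_lagKernel hn l z z' hrs).mul_left _).congr_fun fun j => ?_
    push_cast
    ring

/-- Coefficient of s^k in the preceding formula: up to the factor (2π/|λ|)^n, the kernel is
reproducing. -/
theorem integral_lagKernel_mul_conj (hn : 1 ≤ n) {l : ℝ} (hl : l ≠ 0) (k : ℕ)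
    (z z' : Fin n → ℂ) :
    ∫ w, lagKernel k l z w * (starRingEnd ℂ) (lagKernel k l z' w) =
      (((2 * Real.pi / |l|) ^ n : ℝ) : ℂ) * lagKernel k l z z' := by
  have hcont : Continuous fun w => (starRingEnd ℂ) (lagKernel k l z w) :=
    Complex.continuous_conj.comp (continuous_lagKernel_right k l z)
  have hbd : ∀ w, ‖(starRingEnd ℂ) (lagKernel k l z w)‖ ≤ 5 ^ k * (5 / 4) ^ n := fun w => by
    rw [RCLike.norm_conj]
    refine (norm_lagKernel_le hn k l z w).trans ?_
    have := normSq_nonneg (w - z)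
    have h1 : Real.exp (-(|l| / 8 * normSq (w - z))) ≤ 1 := Real.exp_le_one_iff.mpr (by
      have : 0 ≤ |l| / 8 * normSq (w - z) := by positivity
      linarith)
    gcongr
    exact mul_le_of_le_one_right (by positivity) h1
  have h := congrFun (eq_of_hasSum_pow_mul
    (a := fun j => ∫ w, lagKernel k l z w * (starRingEnd ℂ) (lagKernel j l z' w))
    -- The right-hand side is a single power s^k, so the coefficients with j ≠ k vanish; this is
    -- orthogonality of different degrees, of which only the diagonal case is kept.
    (b := fun j => if j = k then (((2 * Real.pi / |l|) ^ n : ℝ) : ℂ) * lagKernel k l z z' else 0)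
    (S := fun s => (((2 * Real.pi / |l|) ^ n : ℝ) : ℂ) * ((s : ℂ) ^ k * lagKernel k l z z'))
    (show (0 : ℝ) < 1 / 10 by norm_num) (fun s hs => ?_) (fun s hs => ?_)) k
  · simpa using h
  · have := hasSum_integral_lagKernel_mul hn hl z' hcont hbd hs
    have := this.map (starRingEnd ℂ) Complex.continuous_conj
    rw [← integral_conj] at this
    rw [← integral_lagKernel_mul_conj_gaussKernel hn hl k z z' (s := s) (by linarith)]
    convert! this using 1
    · ext j
      rw [Function.comp_apply, map_mul, ← integral_conj, map_pow, Complex.conj_ofReal]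
      congr 2
      ext w
      simp [mul_comm]
    · congr 1
      ext w
      simp [mul_comm]
  · have := hasSum_ite_eq k ((((2 * Real.pi / |l|) ^ n : ℝ) : ℂ) * ((s : ℂ) ^ k *
      lagKernel k l z z'))
    refine this.congr_fun fun j => ?_
    split_ifs with hj
    · subst hj; ring
    · simp

theorem phase_self (l : ℝ) (z : Fin n → ℂ) : phase l z z = 1 := by
  have : (herm z z).im = 0 := by
    simp [herm, Complex.mul_conj]
  simp [phase, this]

theorem integrable_lagKernel_mul_conj (hn : 1 ≤ n) {l : ℝ} (hl : l ≠ 0) (k : ℕ)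
    (z z' : Fin n → ℂ) :
    Integrable fun w => lagKernel k l z w * (starRingEnd ℂ) (lagKernel k l z' w) := by
  refine integrable_lagKernel_mul hn hl k z (Complex.continuous_conj.comp
      (continuous_lagKernel_right k l z'))
    (C := 5 ^ k * (5 / 4) ^ n) fun w => ?_
  rw [RCLike.norm_conj]
  refine (norm_lagKernel_le hn k l z' w).trans ?_
  have := normSq_nonneg (w - z')
  have h1 : Real.exp (-(|l| / 8 * normSq (w - z'))) ≤ 1 := Real.exp_le_one_iff.mpr (by
    have : 0 ≤ |l| / 8 * normSq (w - z') := by positivity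
    linarith)
  gcongr
  exact mul_le_of_le_one_right (by positivity) h1

theorem integral_norm_lagKernel_sq (hn : 1 ≤ n) {l : ℝ} (hl : l ≠ 0) (k : ℕ) (z : Fin n → ℂ) :
    ∫ w, ‖lagKernel k l z w‖ ^ 2 = (2 * Real.pi / |l|) ^ n * laguerreFun n k l 0 := by
  have h := integral_lagKernel_mul_conj hn hl k z z
  simp_rw [Complex.mul_conj, Complex.normSq_eq_norm_sq] at h
  rw [lagKernel, phase_self, one_mul, sub_self, ← Complex.ofReal_mul] at h
  rw [← Complex.ofReal_inj, ← h]
  exact integral_ofReal.symm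

theorem laguerreFun_apply_zero (k : ℕ) (l : ℝ) :
    laguerreFun n k l 0 = (coeff n k)⁻¹ := by
  rw [laguerreFun, normSq_zero, mul_zero, mul_zero, neg_zero, Real.exp_zero, mul_one,
    laguerre_zero, coeff, Nat.cast_add_choose]
  field_simp

theorem coeff_pos (n k : ℕ) : 0 < coeff n k := by unfold coeff; positivity

theorem coeff_le_one (n k : ℕ) : coeff n k ≤ 1 := by
  unfold coeff
  rw [div_le_one (by positivity)]
  exact_mod_cast Nat.le_of_dvd (Nat.factorial_pos _)
      (Nat.factorial_mul_factorial_dvd_factorial_add _ _)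

theorem integrable_norm_lagKernel_sq (hn : 1 ≤ n) {l : ℝ} (hl : l ≠ 0) (k : ℕ) (z : Fin n → ℂ) :
    Integrable fun w => ‖lagKernel k l z w‖ ^ 2 := by
  refine (integrable_lagKernel_mul_conj hn hl k z z).norm.congr (ae_of_all _ fun w => ?_)
  simp [sq]

/-- A reproducing kernel is dominated by its diagonal: |uv̄| ≤ (|u|² + |v|²)/2 in the reproducing
identity, both squares having integral a multiple of φ_k(0) = 1/c_{n,k}. Unlike the bound with 5^k,
this one is sharp and grows only polynomially in k for fixed n. -/
theorem abs_laguerreFun_le (hn : 1 ≤ n) {l : ℝ} (hl : l ≠ 0) (k : ℕ) (z : Fin n → ℂ) :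
    |laguerreFun n k l z| ≤ (coeff n k)⁻¹ := by
  have hc : 0 < (2 * Real.pi / |l|) ^ n := by positivity
  have h := integral_lagKernel_mul_conj hn hl k 0 z
  have h1 : ‖∫ w, lagKernel k l 0 w * (starRingEnd ℂ) (lagKernel k l z w)‖ ≤
      ∫ w, (1 / 2 * ‖lagKernel k l 0 w‖ ^ 2 + 1 / 2 * ‖lagKernel k l z w‖ ^ 2) := by
    refine norm_integral_le_of_norm_le (((integrable_norm_lagKernel_sq hn hl k 0).const_mul _).add
      ((integrable_norm_lagKernel_sq hn hl k z).const_mul _)) (ae_of_all _ fun w => ?_)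
    rw [norm_mul, RCLike.norm_conj]
    nlinarith [sq_nonneg (‖lagKernel k l 0 w‖ - ‖lagKernel k l z w‖)]
  rw [h, integral_add ((integrable_norm_lagKernel_sq hn hl k 0).const_mul _)
      ((integrable_norm_lagKernel_sq hn hl k z).const_mul _), integral_const_mul,
    integral_const_mul, integral_norm_lagKernel_sq hn hl, integral_norm_lagKernel_sq hn hl,
    laguerreFun_apply_zero, norm_mul, Complex.norm_real, Real.norm_of_nonneg hc.le, lagKernel,
    norm_mul, norm_phase, one_mul, sub_zero, Complex.norm_real, Real.norm_eq_abs] at h1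
  refine le_of_mul_le_mul_left (a := (2 * Real.pi / |l|) ^ n) ?_ hc
  linarith

theorem norm_lagKernel_le_coeff (hn : 1 ≤ n) {l : ℝ} (hl : l ≠ 0) (k : ℕ) (z w : Fin n → ℂ) :
    ‖lagKernel k l z w‖ ≤ (coeff n k)⁻¹ := by
  rw [lagKernel, norm_mul, norm_phase, one_mul, Complex.norm_real]
  exact abs_laguerreFun_le hn hl k _

theorem hasSum_pow_mul_inv_coeff (hn : 1 ≤ n) {r : ℝ} (hr : |r| < 1) :
    HasSum (fun k => r ^ k * (coeff n k)⁻¹) ((1 - r) ^ n)⁻¹ := by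
  have := hasSum_laguerreFun hn 0 (0 : Fin n → ℂ) hr
  simpa [laguerreFun_apply_zero] using this

/-! ### Plancherel theorem for Laguerre expansions under twisted convolution -/

/-- The twisted convolution of `g` with the Laguerre function `φ_{k,λ}^{n-1}`. -/
def twConv (k : ℕ) (l : ℝ) (g : (Fin n → ℂ) → ℂ) (w : Fin n → ℂ) : ℂ :=
  ∫ z, g z * lagKernel k l z w

theorem integrable_mul_conj_prod {g : (Fin n → ℂ) → ℂ} (hg : Integrable g) :
    Integrable fun x : (Fin n → ℂ) × (Fin n → ℂ) => (starRingEnd ℂ) (g x.1) * g x.2 := by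
  have h : Integrable fun z => (starRingEnd ℂ) (g z) :=
    (RCLike.conjLIE (K := ℂ)).toContinuousLinearEquiv.integrable_comp_iff.mpr hg
  exact h.mul_prod hg

theorem integrable_mul_conj_prod_mul {g : (Fin n → ℂ) → ℂ} (hg : Integrable g)
    {K : (Fin n → ℂ) → (Fin n → ℂ) → ℂ} (hK : Continuous fun p : (Fin n → ℂ) × (Fin n → ℂ) =>
      K p.1 p.2) {C : ℝ} (hC : ∀ z w, ‖K z w‖ ≤ C) :
    Integrable fun x : (Fin n → ℂ) × (Fin n → ℂ) =>
      (starRingEnd ℂ) (g x.1) * g x.2 * K x.2 x.1 := by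
  have hc : Continuous fun x : (Fin n → ℂ) × (Fin n → ℂ) => K x.2 x.1 := hK.comp continuous_swap
  exact (integrable_mul_conj_prod hg).mul_bdd (c := C) hc.aestronglyMeasurable
    (ae_of_all _ fun x => hC x.2 x.1)

/-- Expanding the square gives a triple integral; integrating over w before the other variables lets
the reproducing identity collapse two kernels into one. -/
theorem twConv_norm_sq (hn : 1 ≤ n) {l : ℝ} (hl : l ≠ 0) (k : ℕ) {g : (Fin n → ℂ) → ℂ}
    (hg : Integrable g) :
    Integrable (fun w => ‖twConv k l g w‖ ^ 2) ∧
    ((∫ w, ‖twConv k l g w‖ ^ 2 : ℝ) : ℂ) = (((2 * Real.pi / |l|) ^ n : ℝ) : ℂ) *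
      ∫ x : (Fin n → ℂ) × (Fin n → ℂ),
        (starRingEnd ℂ) (g x.1) * g x.2 * lagKernel k l x.2 x.1 := by
  let Φ : ((Fin n → ℂ) × (Fin n → ℂ)) × (Fin n → ℂ) → ℂ := fun p =>
    (starRingEnd ℂ) (g p.1.1) * g p.1.2 *
      (lagKernel k l p.1.2 p.2 * (starRingEnd ℂ) (lagKernel k l p.1.1 p.2))
  have hQ := integrable_mul_conj_prod hg
  have hK := continuous_lagKernel (n := n) k l
  have hΦm : AEStronglyMeasurable Φ (volume.prod volume) := by
    refine (hQ.1.comp_fst).mul (Continuous.aestronglyMeasurable ?_)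
    have h1 : Continuous fun p : ((Fin n → ℂ) × (Fin n → ℂ)) × (Fin n → ℂ) =>
      lagKernel k l p.1.2 p.2 := by
      have := hK.comp (by fun_prop : Continuous fun p :
        ((Fin n → ℂ) × (Fin n → ℂ)) × (Fin n → ℂ) => (p.1.2, p.2))
      exact this
    have h2 : Continuous fun p : ((Fin n → ℂ) × (Fin n → ℂ)) × (Fin n → ℂ) =>
      lagKernel k l p.1.1 p.2 := by
      have := hK.comp (by fun_prop : Continuous fun p :
        ((Fin n → ℂ) × (Fin n → ℂ)) × (Fin n → ℂ) => (p.1.1, p.2))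
      exact this
    exact h1.mul (Complex.continuous_conj.comp h2)
  set D := (2 * Real.pi / |l|) ^ n * laguerreFun n k l 0 with hD
  have hΦ : Integrable Φ (volume.prod volume) := by
    rw [integrable_prod_iff hΦm]
    refine ⟨ae_of_all _ fun x => (integrable_lagKernel_mul_conj hn hl k x.2 x.1).const_mul
      ((starRingEnd ℂ) (g x.1) * g x.2), ?_⟩
    refine (hQ.norm.mul_const D).mono' hΦm.norm.integral_prod_right' (ae_of_all _ fun x => ?_)
    rw [Real.norm_of_nonneg (integral_nonneg fun _ => norm_nonneg _)]
    simp only [Φ, norm_mul _ (lagKernel k l _ _ * _)]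
    rw [integral_const_mul]
    refine mul_le_mul_of_nonneg_left ?_ (norm_nonneg _)
    have h1 := integrable_norm_lagKernel_sq hn hl k x.1
    have h2 := integrable_norm_lagKernel_sq hn hl k x.2
    calc ∫ w, ‖lagKernel k l x.2 w * (starRingEnd ℂ) (lagKernel k l x.1 w)‖
        ≤ ∫ w, (1 / 2 * ‖lagKernel k l x.1 w‖ ^ 2 + 1 / 2 * ‖lagKernel k l x.2 w‖ ^ 2) := by
          refine integral_mono (integrable_lagKernel_mul_conj hn hl k x.2 x.1).norm
            ((h1.const_mul _).add (h2.const_mul _)) fun w => ?_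
          simp only [norm_mul, RCLike.norm_conj]
          nlinarith [sq_nonneg (‖lagKernel k l x.1 w‖ - ‖lagKernel k l x.2 w‖)]
      _ = D := by
          rw [integral_add (h1.const_mul _) (h2.const_mul _), integral_const_mul,
            integral_const_mul, integral_norm_lagKernel_sq hn hl, integral_norm_lagKernel_sq hn hl]
          ring
  have hw : ∀ w, ∫ x, Φ (x, w) = ((‖twConv k l g w‖ ^ 2 : ℝ) : ℂ) := by
    intro w
    have e : ∀ x : (Fin n → ℂ) × (Fin n → ℂ), Φ (x, w) =
        (starRingEnd ℂ) (g x.1 * lagKernel k l x.1 w) * (g x.2 * lagKernel k l x.2 w) := by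
      intro x; simp only [Φ, map_mul]; ring
    simp_rw [e]
    rw [Measure.volume_eq_prod, integral_prod_mul (fun z => (starRingEnd ℂ) (g z *
        lagKernel k l z w))
      (fun z => g z * lagKernel k l z w), integral_conj, ← Complex.normSq_eq_norm_sq,
      Complex.normSq_eq_conj_mul_self, twConv]
  have hx : ∀ x : (Fin n → ℂ) × (Fin n → ℂ), ∫ w, Φ (x, w) =
      (((2 * Real.pi / |l|) ^ n : ℝ) : ℂ) *
        ((starRingEnd ℂ) (g x.1) * g x.2 * lagKernel k l x.2 x.1) := by
    intro x
    simp only [Φ]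
    rw [integral_const_mul, integral_lagKernel_mul_conj hn hl]
    ring
  constructor
  · have := hΦ.integral_prod_right
    simp_rw [hw] at this
    exact this.re
  · have := integral_integral_swap (f := fun x w => Φ (x, w)) hΦ
    simp_rw [hw, hx] at this
    rw [integral_const_mul] at this
    rw [this]
    exact integral_ofReal.symm

/-- Here the whole range |r| < 1 is needed, since r → 1 follows; the sharp bound 1/c_{n,k} provides
the summable majorant. -/
theorem hasSum_pow_mul_twConv_norm_sq (hn : 1 ≤ n) {l : ℝ} (hl : l ≠ 0) {g : (Fin n → ℂ) → ℂ}
    (hg : Integrable g) {r : ℝ} (hr : |r| < 1) :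
    HasSum (fun k => (((r ^ k * ∫ w, ‖twConv k l g w‖ ^ 2) : ℝ) : ℂ))
      ((((2 * Real.pi / |l|) ^ n : ℝ) : ℂ) * ∫ x : (Fin n → ℂ) × (Fin n → ℂ),
        (starRingEnd ℂ) (g x.1) * g x.2 * gaussKernel l r x.2 x.1) := by
  have hQ := integrable_mul_conj_prod hg
  have hi : ∀ k, Integrable fun x : (Fin n → ℂ) × (Fin n → ℂ) =>
      (starRingEnd ℂ) (g x.1) * g x.2 * lagKernel k l x.2 x.1 := fun k =>
    integrable_mul_conj_prod_mul hg (continuous_lagKernel k l)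
      (norm_lagKernel_le_coeff hn hl k)
  have hs : Summable fun k => ∫ x : (Fin n → ℂ) × (Fin n → ℂ),
      ‖(r : ℂ) ^ k * ((starRingEnd ℂ) (g x.1) * g x.2 * lagKernel k l x.2 x.1)‖ := by
    set D := ∫ x : (Fin n → ℂ) × (Fin n → ℂ), ‖(starRingEnd ℂ) (g x.1) * g x.2‖ with hD
    refine Summable.of_nonneg_of_le (fun k => integral_nonneg fun w => norm_nonneg _)
      (fun k => ?_) ((hasSum_pow_mul_inv_coeff hn (r := |r|)
          (by simpa using hr)).summable.mul_right D)
    rw [hD, ← integral_const_mul]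
    refine integral_mono ((hi k).const_mul _).norm (hQ.norm.const_mul _) fun x => ?_
    simp only [norm_mul _ (lagKernel k l _ _), norm_mul ((r : ℂ) ^ k) _, norm_pow,
      Complex.norm_real, Real.norm_eq_abs]
    rw [mul_assoc, mul_comm (coeff n k)⁻¹]
    gcongr
    exact norm_lagKernel_le_coeff hn hl k _ _
  have h := hasSum_integral_of_summable_integral_norm (F := fun k
    (x : (Fin n → ℂ) × (Fin n → ℂ)) =>
    (r : ℂ) ^ k * ((starRingEnd ℂ) (g x.1) * g x.2 * lagKernel k l x.2 x.1))
    (fun k => (hi k).const_mul _) hs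
  have e : ∀ x : (Fin n → ℂ) × (Fin n → ℂ),
      ∑' k, (r : ℂ) ^ k * ((starRingEnd ℂ) (g x.1) * g x.2 * lagKernel k l x.2 x.1) =
        (starRingEnd ℂ) (g x.1) * g x.2 * gaussKernel l r x.2 x.1 := by
    intro x
    rw [← (hasSum_lagKernel hn l x.2 x.1 hr).tsum_eq, ← tsum_mul_left]
    exact tsum_congr fun k => by ring
  simp_rw [e] at h
  refine (h.mul_left _).congr_fun fun k => ?_
  rw [Complex.ofReal_mul, (twConv_norm_sq hn hl k hg).2, integral_const_mul]
  push_cast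
  ring

/-! ### The limit r → 1: twisted autocorrelation and Abel summation -/

theorem enorm_integral_mul_le {α : Type*} {m : MeasurableSpace α} {μ : Measure α} {f g : α → ℂ}
    (hf : AEStronglyMeasurable f μ) (hg : AEStronglyMeasurable g μ) :
    ‖∫ x, f x * g x ∂μ‖ₑ ≤ eLpNorm f 2 μ * eLpNorm g 2 μ := by
  refine (enorm_integral_le_lintegral_enorm _).trans ?_
  rw [← eLpNorm_one_eq_lintegral_enorm]
  have := eLpNorm_le_eLpNorm_mul_eLpNorm_of_nnnorm (p := 2) (q := 2) (r := 1) hf hg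
    (fun a b => a * b) 1 (ae_of_all _ fun x => by simp [nnnorm_mul])
  simpa using this

/-- The twisted autocorrelation of `g`. -/
def autocorr (l : ℝ) (g : (Fin n → ℂ) → ℂ) (u : Fin n → ℂ) : ℂ :=
  ∫ z, g (u + z) * (phase l u z * (starRingEnd ℂ) (g z))

theorem eLpNorm_phase_mul_conj (l : ℝ) (u : Fin n → ℂ) (g : (Fin n → ℂ) → ℂ) :
    eLpNorm (fun z => phase l u z * (starRingEnd ℂ) (g z)) 2 volume = eLpNorm g 2 volume :=
  eLpNorm_congr_norm_ae (ae_of_all _ fun z => by simp [norm_phase])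

theorem continuous_phase_right (l : ℝ) (u : Fin n → ℂ) : Continuous fun z => phase l u z := by
  have := (continuous_phase (n := n) l).comp (Continuous.prodMk_right u)
  exact this

theorem continuous_phase_left (l : ℝ) (z : Fin n → ℂ) : Continuous fun u => phase l u z := by
  have := (continuous_phase (n := n) l).comp (Continuous.prodMk_left z)
  exact this

theorem aestronglyMeasurable_phase_mul_conj (l : ℝ) (u : Fin n → ℂ) {g : (Fin n → ℂ) → ℂ}
    (hg : AEStronglyMeasurable g volume) :
    AEStronglyMeasurable (fun z => phase l u z * (starRingEnd ℂ) (g z)) volume :=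
  (continuous_phase_right l u).aestronglyMeasurable.mul
    (Complex.continuous_conj.comp_aestronglyMeasurable hg)

theorem memLp_comp_add {g : (Fin n → ℂ) → ℂ} (hg : MemLp g 2 volume) (u : Fin n → ℂ) :
    MemLp (fun z => g (u + z)) 2 volume :=
  hg.comp_measurePreserving (measurePreserving_add_left volume u)

theorem eLpNorm_comp_add {g : (Fin n → ℂ) → ℂ} (hg : MemLp g 2 volume) (u : Fin n → ℂ) :
    eLpNorm (fun z => g (u + z)) 2 volume = eLpNorm g 2 volume :=
  eLpNorm_comp_measurePreserving hg.1 (measurePreserving_add_left volume u)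

theorem norm_autocorr_le (l : ℝ) {g : (Fin n → ℂ) → ℂ} (hg : MemLp g 2 volume) (u : Fin n → ℂ) :
    ‖autocorr l g u‖ ≤ (eLpNorm g 2 volume * eLpNorm g 2 volume).toReal := by
  have h := enorm_integral_mul_le (memLp_comp_add hg u).1
    (aestronglyMeasurable_phase_mul_conj l u hg.1)
  rw [eLpNorm_phase_mul_conj, eLpNorm_comp_add hg] at h
  rw [← toReal_enorm]
  exact ENNReal.toReal_mono (ENNReal.mul_ne_top hg.eLpNorm_ne_top hg.eLpNorm_ne_top) h

theorem tendsto_eLpNorm_translate {g : (Fin n → ℂ) → ℂ} (hg : MemLp g 2 volume)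
    (u₀ : Fin n → ℂ) :
    Filter.Tendsto (fun u => eLpNorm (fun z => g (u + z) - g (u₀ + z)) 2 volume) (𝓝 u₀) (𝓝 0) := by
  let τ : C(Fin n → ℂ, C(Fin n → ℂ, Fin n → ℂ)) :=
    (ContinuousMap.mk (fun a : (Fin n → ℂ) × (Fin n → ℂ) => a.1 + a.2)).curry
  have hc := (continuous_const (y := hg.toLp g)).compMeasurePreservingLp τ.continuous
    (fun u => measurePreserving_add_left volume u) (by norm_num)
  have h1 : ∀ u : Fin n → ℂ, Lp.compMeasurePreserving (τ u)
      (measurePreserving_add_left volume u) (hg.toLp g) = (memLp_comp_add hg u).toLp _ :=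
    fun u => rfl
  simp_rw [h1] at hc
  have h2 := tendsto_iff_edist_tendsto_0.mp (hc.tendsto u₀)
  simp_rw [Lp.edist_toLp_toLp] at h2
  exact h2

/-- The translation and the phase are varied separately: the translation by continuity of
translations in L² and Cauchy–Schwarz, the phase by dominated convergence. -/
theorem continuous_autocorr (l : ℝ) {g : (Fin n → ℂ) → ℂ} (hg : MemLp g 2 volume) :
    Continuous (autocorr l g) := by
  rw [continuous_iff_continuousAt]
  intro u₀
  have hInt : ∀ u v : Fin n → ℂ,
      Integrable fun z => g (u + z) * (phase l v z * (starRingEnd ℂ) (g z)) := fun u v =>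
    MemLp.integrable_mul (p := 2) (q := 2) (memLp_comp_add hg u)
      ⟨aestronglyMeasurable_phase_mul_conj l v hg.1, by
        rw [eLpNorm_phase_mul_conj]; exact hg.2⟩
  have hA : Filter.Tendsto (fun u => ∫ z, g (u₀ + z) * (phase l u z * (starRingEnd ℂ) (g z)))
      (𝓝 u₀) (𝓝 (autocorr l g u₀)) := by
    refine tendsto_integral_filter_of_dominated_convergence
      (fun z => ‖g (u₀ + z) * (phase l u₀ z * (starRingEnd ℂ) (g z))‖)
      (Filter.Eventually.of_forall fun u => (hInt u₀ u).1)
      (Filter.Eventually.of_forall fun u => ae_of_all _ fun z => by simp [norm_phase])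
      (hInt u₀ u₀).norm (ae_of_all _ fun z => ?_)
    exact ((((continuous_phase_left l z).tendsto u₀).mul_const _).const_mul _)
  have hB : Filter.Tendsto (fun u => autocorr l g u -
      ∫ z, g (u₀ + z) * (phase l u z * (starRingEnd ℂ) (g z))) (𝓝 u₀) (𝓝 0) := by
    rw [tendsto_zero_iff_enorm_tendsto_zero]
    have hlim : Filter.Tendsto (fun u => eLpNorm (fun z => g (u + z) - g (u₀ + z)) 2 volume *
        eLpNorm g 2 volume) (𝓝 u₀) (𝓝 0) := by
      have := ENNReal.Tendsto.mul_const (b := eLpNorm g 2 volume) (tendsto_eLpNorm_translate hg u₀)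
        (Or.inr hg.eLpNorm_ne_top)
      rwa [zero_mul] at this
    refine tendsto_of_tendsto_of_tendsto_of_le_of_le tendsto_const_nhds hlim
      (fun _ => zero_le) fun u => ?_
    simp only [autocorr]
    rw [← integral_sub (hInt u u) (hInt u₀ u)]
    have h := enorm_integral_mul_le
      ((memLp_comp_add hg u).1.sub (memLp_comp_add hg u₀).1)
      (aestronglyMeasurable_phase_mul_conj l u hg.1)
    rw [eLpNorm_phase_mul_conj] at h
    refine le_trans (le_of_eq ?_) h
    congr 2
    ext z
    simp only [Pi.sub_apply]
    ring
  have := hB.add hA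
  simp only [sub_add_cancel, zero_add] at this
  exact this

theorem phase_add_self (l : ℝ) (u z : Fin n → ℂ) : phase l (z + u) z = phase l u z := by
  have : (herm (z + u) z).im = (herm u z).im := by
    simp [herm, add_mul, Finset.sum_add_distrib, Complex.mul_conj]
  simp [phase, this]

/-- The kernel depends on the difference u of its arguments up to a phase, so the integral is a
Gaussian average of the autocorrelation. Rescaling u = √(1-r) v in real dimension 2n absorbs the
factor (1-r)^{-n} and leaves an integrand with a pointwise limit as r → 1. -/
theorem integral_mul_gaussKernel_eq_autocorr {l r : ℝ} (hr : |r| < 1) {g : (Fin n → ℂ) → ℂ}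
    (hg : Integrable g) :
    ∫ x : (Fin n → ℂ) × (Fin n → ℂ), (starRingEnd ℂ) (g x.1) * g x.2 * gaussKernel l r x.2 x.1 =
      ∫ v : Fin n → ℂ, ((Real.exp (-(|l| / 4 * (1 + r) * normSq v)) : ℝ) : ℂ) *
        autocorr l g (Real.sqrt (1 - r) • v) := by
  have hr' : 0 < 1 - r := by linarith [(abs_lt.mp hr).2]
  have hi := integrable_mul_conj_prod_mul hg (continuous_gaussKernel l r)
    (norm_gaussKernel_le (l := l) hr)
  have hi' := (measurePreserving_prod_add (volume : Measure
      (Fin n → ℂ)) volume).integrable_comp_of_integrable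
    hi
  rw [Measure.volume_eq_prod, integral_prod _ hi]
  have e1 : ∀ z' : Fin n → ℂ, ∫ z, (starRingEnd ℂ) (g z') * g z * gaussKernel l r z z' =
      ∫ u, (starRingEnd ℂ) (g z') * g (z' + u) * gaussKernel l r (z' + u) z' := fun z' =>
    (integral_add_left_eq_self (fun z => (starRingEnd ℂ) (g z') * g z *
        gaussKernel l r z z') z').symm
  simp_rw [e1]
  rw [integral_integral_swap (f := fun z' u =>
    (starRingEnd ℂ) (g z') * g (z' + u) * gaussKernel l r (z' + u) z') hi']
  set F : (Fin n → ℂ) → ℂ := fun u =>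
    ((Real.exp (-(|l| / 4 * ((1 + r) / (1 - r)) * normSq u)) : ℝ) : ℂ) * autocorr l g u with hF
  have e2 : ∀ u : Fin n → ℂ,
      ∫ z', (starRingEnd ℂ) (g z') * g (z' + u) * gaussKernel l r (z' + u) z' =
        ((((1 - r) ^ n)⁻¹ : ℝ) : ℂ) * F u := by
    intro u
    simp only [hF, autocorr]
    rw [← integral_const_mul, ← integral_const_mul]
    congr 1
    ext z
    rw [gaussKernel, phase_add_self, sub_add_cancel_left, normSq_neg, add_comm u z]
    push_cast
    ring
  simp_rw [e2]
  rw [integral_const_mul]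
  have h3 := Measure.integral_comp_smul_of_nonneg (volume : Measure (Fin n → ℂ)) F (Real.sqrt
      (1 - r))
    (hR := Real.sqrt_nonneg _)
  have h4 : Module.finrank ℝ (Fin n → ℂ) = 2 * n := by
    rw [Module.finrank_pi_fintype]; simp [mul_comm]
  rw [h4, pow_mul, Real.sq_sqrt hr'.le] at h3
  rw [← Complex.real_smul, ← h3]
  congr 1
  ext v
  rw [hF]
  simp only
  have h5 : normSq (Real.sqrt (1 - r) • v) = (1 - r) * normSq v := by
    simp only [normSq, Pi.smul_apply, norm_smul, mul_pow, Real.norm_eq_abs, sq_abs,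
      Real.sq_sqrt hr'.le, Finset.mul_sum]
  rw [h5]
  congr 4
  field_simp

theorem autocorr_zero (l : ℝ) (g : (Fin n → ℂ) → ℂ) :
    autocorr l g 0 = ((∫ z, ‖g z‖ ^ 2 : ℝ) : ℂ) := by
  rw [autocorr, ← integral_complex_ofReal]
  congr 1
  ext z
  have : phase l 0 z = 1 := by simp [phase, herm]
  rw [zero_add, this, one_mul, Complex.mul_conj, Complex.normSq_eq_norm_sq]

theorem tendsto_integral_mul_gaussKernel {l : ℝ} (hl : l ≠ 0) {g : (Fin n → ℂ) → ℂ}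
    (hg : Integrable g) (hg2 : MemLp g 2 volume) :
    Filter.Tendsto (fun r : ℝ => ∫ x : (Fin n → ℂ) × (Fin n → ℂ),
        (starRingEnd ℂ) (g x.1) * g x.2 * gaussKernel l r x.2 x.1) (𝓝[<] 1)
      (𝓝 ((((2 * Real.pi / |l|) ^ n * ∫ z, ‖g z‖ ^ 2 : ℝ)) : ℂ)) := by
  have hl' : 0 < |l| := abs_pos.mpr hl
  have hcont := continuous_autocorr l hg2
  have hmem : Set.Ioo (0 : ℝ) 1 ∈ 𝓝[<] (1 : ℝ) := Ioo_mem_nhdsLT one_pos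
  have hlim : Filter.Tendsto (fun r : ℝ => ∫ v : Fin n → ℂ,
      ((Real.exp (-(|l| / 4 * (1 + r) * normSq v)) : ℝ) : ℂ) *
        autocorr l g (Real.sqrt (1 - r) • v)) (𝓝[<] 1)
      (𝓝 (∫ v : Fin n → ℂ, ((Real.exp (-(|l| / 4 * (1 + 1) * normSq v)) : ℝ) : ℂ) *
        autocorr l g 0)) := by
    refine tendsto_integral_filter_of_dominated_convergence
      (fun v => Real.exp (-(|l| / 4 * normSq v)) *
        (eLpNorm g 2 volume * eLpNorm g 2 volume).toReal)
      (Filter.Eventually.of_forall fun r => Continuous.aestronglyMeasurable ?_)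
      ?_ ((integrable_gaussian_normSq (by positivity)).mul_const _) (ae_of_all _ fun v => ?_)
    · fun_prop
    · filter_upwards [hmem] with r hr
      refine ae_of_all _ fun v => ?_
      rw [norm_mul, Complex.norm_real, Real.norm_of_nonneg (Real.exp_pos _).le]
      refine mul_le_mul (Real.exp_le_exp.mpr ?_) (norm_autocorr_le l hg2 _) (norm_nonneg _)
        (Real.exp_pos _).le
      have := normSq_nonneg v
      have : 0 ≤ |l| / 4 * r * normSq v := by have := hr.1; positivity
      linarith
    · refine Filter.Tendsto.mono_left ?_ nhdsWithin_le_nhds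
      have hc : Continuous fun r : ℝ => ((Real.exp (-(|l| / 4 * (1 + r) * normSq v)) : ℝ) : ℂ) *
        autocorr l g (Real.sqrt (1 - r) • v) := by fun_prop
      have := hc.tendsto 1
      simpa using this
  have hval : ∫ v : Fin n → ℂ, ((Real.exp (-(|l| / 4 * (1 + 1) * normSq v)) : ℝ) : ℂ) *
        autocorr l g 0 = (((2 * Real.pi / |l|) ^ n * ∫ z, ‖g z‖ ^ 2 : ℝ) : ℂ) := by
    rw [integral_mul_const, autocorr_zero, integral_complex_ofReal,
      integral_gaussian_normSq (by positivity), ← Complex.ofReal_mul]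
    congr 3
    field_simp
    ring
  rw [hval] at hlim
  refine hlim.congr' ?_
  filter_upwards [hmem] with r hr
  exact (integral_mul_gaussKernel_eq_autocorr (abs_lt.mpr ⟨by linarith [hr.1], hr.2⟩) hg).symm

/-- A Tauberian statement that holds because the terms are nonnegative: partial sums stay below the
Abel limit, and the Abel sums stay below the full sum. -/
theorem hasSum_of_tendsto_pow_mul {a : ℕ → ℝ} (ha : ∀ k, 0 ≤ a k) {S : ℝ → ℝ} {L : ℝ}
    (hS : ∀ r ∈ Set.Ioo (0 : ℝ) 1, HasSum (fun k => r ^ k * a k) (S r))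
    (hL : Filter.Tendsto S (𝓝[<] 1) (𝓝 L)) : HasSum a L := by
  have hmem : Set.Ioo (0 : ℝ) 1 ∈ 𝓝[<] (1 : ℝ) := Ioo_mem_nhdsLT one_pos
  have hpart : ∀ s : Finset ℕ, ∑ k ∈ s, a k ≤ L := by
    intro s
    have h1 : Filter.Tendsto (fun r : ℝ => ∑ k ∈ s, r ^ k * a k) (𝓝[<] 1) (𝓝 (∑ k ∈ s, a k)) := by
      have hc : Continuous fun r : ℝ => ∑ k ∈ s, r ^ k * a k := by fun_prop
      have := hc.tendsto 1
      simp only [one_pow, one_mul] at this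
      exact this.mono_left nhdsWithin_le_nhds
    refine le_of_tendsto_of_tendsto h1 hL ?_
    filter_upwards [hmem] with r hr
    exact sum_le_hasSum s (fun k _ => mul_nonneg (pow_nonneg hr.1.le k) (ha k)) (hS r hr)
  have hsum : Summable a := summable_of_sum_le ha hpart
  have h2 : ∑' k, a k ≤ L := hsum.tsum_le_of_sum_le hpart
  have h3 : L ≤ ∑' k, a k := by
    refine le_of_tendsto hL ?_
    filter_upwards [hmem] with r hr
    refine hasSum_le (fun k => ?_) (hS r hr) hsum.hasSum
    exact mul_le_of_le_one_left (ha k) (pow_le_one₀ hr.1.le hr.2.le)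
  rw [← le_antisymm h2 h3]
  exact hsum.hasSum

theorem hasSum_twConv_norm_sq (hn : 1 ≤ n) {l : ℝ} (hl : l ≠ 0) {g : (Fin n → ℂ) → ℂ}
    (hg : Integrable g) (hg2 : MemLp g 2 volume) :
    HasSum (fun k => ∫ w, ‖twConv k l g w‖ ^ 2)
      ((2 * Real.pi / |l|) ^ (2 * n) * ∫ z, ‖g z‖ ^ 2) := by
  refine hasSum_of_tendsto_pow_mul (fun k => integral_nonneg fun w => by positivity)
    (S := fun r => ((((2 * Real.pi / |l|) ^ n : ℝ) : ℂ) * ∫ x : (Fin n → ℂ) × (Fin n → ℂ),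
        (starRingEnd ℂ) (g x.1) * g x.2 * gaussKernel l r x.2 x.1).re) (fun r hr => ?_) ?_
  · have := hasSum_pow_mul_twConv_norm_sq hn hl hg (r := r)
      (abs_lt.mpr ⟨by linarith [hr.1], hr.2⟩)
    exact Complex.hasSum_re this
  · have := ((tendsto_integral_mul_gaussKernel hl hg hg2).const_mul
      (((2 * Real.pi / |l|) ^ n : ℝ) : ℂ))
    have := (Complex.continuous_re.tendsto _).comp this
    rw [← Complex.ofReal_mul, Complex.ofReal_re, ← mul_assoc, ← pow_add, ← two_mul] at this
    exact this

theorem tsum_lintegral_twConv (hn : 1 ≤ n) {l : ℝ} (hl : l ≠ 0) {g : (Fin n → ℂ) → ℂ}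
    (hg : Integrable g) (hg2 : MemLp g 2 volume) :
    ∑' k, ∫⁻ w, ‖twConv k l g w‖ₑ ^ 2 =
      ENNReal.ofReal ((2 * Real.pi / |l|) ^ (2 * n)) * ∫⁻ z, ‖g z‖ₑ ^ 2 := by
  have e : ∀ h : (Fin n → ℂ) → ℂ, Integrable (fun z => ‖h z‖ ^ 2) →
      ∫⁻ z, ‖h z‖ₑ ^ 2 = ENNReal.ofReal (∫ z, ‖h z‖ ^ 2) := fun h hh => by
    rw [ofReal_integral_eq_lintegral_ofReal hh (ae_of_all _ fun z => by positivity)]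
    refine lintegral_congr fun z => ?_
    rw [ENNReal.ofReal_pow (norm_nonneg _), ofReal_norm]
  rw [e g (hg2.integrable_norm_pow (by norm_num)), ← ENNReal.ofReal_mul (by positivity),
    ← (hasSum_twConv_norm_sq hn hl hg hg2).tsum_eq,
    ENNReal.ofReal_tsum_of_nonneg (fun k => integral_nonneg fun w => by positivity)
      (hasSum_twConv_norm_sq hn hl hg hg2).summable]
  exact tsum_congr fun k => e _ (twConv_norm_sq hn hl k hg).1

/-! ### Plancherel's theorem for `L¹ ∩ L²` and Benedicks' theorem on the line -/

section Benedicks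

open scoped FourierTransform SchwartzMap

theorem continuous_fourier {f : ℝ → ℂ} (hf : Integrable f) : Continuous (𝓕 f) :=
  VectorFourier.fourierIntegral_continuous Real.continuous_fourierChar
    (L := innerₗ ℝ) continuous_inner hf

/-- The L² Fourier transform is characterised through tempered distributions and the integral one
satisfies the multiplication formula, so both pair equally with every compactly supported smooth
function. -/
theorem toLp_fourier_ae_eq {f : ℝ → ℂ} (hf : Integrable f) (hf2 : MemLp f 2 volume) :
    ((𝓕 (hf2.toLp f) : Lp ℂ 2 (volume : Measure ℝ)) : ℝ → ℂ) =ᵐ[volume] 𝓕 f := by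
  refine ae_eq_of_integral_contDiff_smul_eq
    ((Lp.memLp _).locallyIntegrable (by norm_num)) (continuous_fourier hf).locallyIntegrable
    fun g hg hgc => ?_
  have hg₁ : HasCompactSupport (Complex.ofRealCLM ∘ g) := hgc.comp_left rfl
  have hg₂ : ContDiff ℝ (⊤ : ℕ∞) (Complex.ofRealCLM ∘ g) := by fun_prop
  let G : 𝓢(ℝ, ℂ) := hg₁.toSchwartzMap hg₂
  have h1 := congrArg (fun T => T G) (Lp.fourier_toTemperedDistribution_eq (hf2.toLp f))
  simp only [TemperedDistribution.fourier_apply, Lp.toTemperedDistribution_apply] at h1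
  have h2 : ∫ ξ, (𝓕 (G : ℝ → ℂ)) ξ • f ξ = ∫ x, G x • (𝓕 f) x := by
    simpa using! VectorFourier.integral_fourierIntegral_smul_eq_flip (L := innerₗ ℝ)
      Real.continuous_fourierChar continuous_inner G.integrable hf
  have h3 : ∫ x, (𝓕 G) x • (hf2.toLp f) x = ∫ ξ, (𝓕 (G : ℝ → ℂ)) ξ • f ξ := by
    refine integral_congr_ae ?_
    filter_upwards [hf2.coeFn_toLp] with x hx
    rw [hx, SchwartzMap.fourier_coe]
  rw [h3, h2] at h1
  have h4 : ∀ x (c : ℂ), G x • c = g x • c := fun x c => by simp [G]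
  simp_rw [h4] at h1
  exact h1.symm

theorem eLpNorm_fourier_eq {f : ℝ → ℂ} (hf : Integrable f) (hf2 : MemLp f 2 volume) :
    eLpNorm (𝓕 f) 2 volume = eLpNorm f 2 volume := by
  rw [← eLpNorm_congr_ae (toLp_fourier_ae_eq hf hf2), ← Lp.enorm_def,
      ← eLpNorm_congr_ae hf2.coeFn_toLp,
    ← Lp.enorm_def]
  have := Lp.norm_fourier_eq (hf2.toLp f)
  rw [← ofReal_norm, ← ofReal_norm, this]

/-! ### Benedicks' theorem by periodization -/

/-- Borel–Cantelli on each period: the measures of the traces of the translates add up to at most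
the measure of `s`. -/
theorem ae_finite_translates {s : Set ℝ} (hsm : MeasurableSet s) (hs : volume s ≠ ∞) {c : ℝ}
    (hc : 0 < c) : ∀ᵐ ξ : ℝ, {m : ℤ | ξ + m * c ∈ s}.Finite := by
  have key : ∀ j : ℤ, ∀ᵐ ξ ∂(volume.restrict (Set.Ioc (j • c) ((j + 1) • c))),
      {m : ℤ | ξ + m * c ∈ s}.Finite := by
    intro j
    let t : ℤ → Set ℝ := fun m => {ξ | ξ + m * c ∈ s}
    have htm : ∀ m, MeasurableSet (t m) := fun m => (measurable_add_const _) hsm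
    have hmeas : ∀ m, volume.restrict (Set.Ioc (j • c) ((j + 1) • c)) (t m) =
        volume (s ∩ Set.Ioc (j • c + m • c) (j • c + (m + 1) • c)) := by
      intro m
      rw [Measure.restrict_apply (htm m),
        ← measure_preimage_add_right volume ((m : ℝ) * c) (s ∩ _)]
      congr 1
      ext ξ
      simp only [t, Set.mem_inter_iff, Set.mem_ofPred_eq, Set.mem_preimage, Set.mem_Ioc,
          zsmul_eq_mul]
      push_cast
      refine and_congr_right fun _ => and_congr ⟨fun h => by linarith, fun h => by linarith⟩
        ⟨fun h => by linarith, fun h => by linarith⟩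
    have hsum : ∑' m, volume.restrict (Set.Ioc (j • c) ((j + 1) • c)) (t m) ≠ ∞ := by
      simp_rw [hmeas]
      rw [← measure_iUnion _ fun m => hsm.inter measurableSet_Ioc]
      · exact ne_top_of_le_ne_top hs (measure_mono
          (Set.iUnion_subset fun m => Set.inter_subset_left))
      · intro a b hab
        exact ((Set.pairwise_disjoint_Ioc_add_zsmul (j • c) c) hab).mono Set.inter_subset_right
          Set.inter_subset_right
    have h0 := measure_limsup_cofinite_eq_zero hsum
    rw [Filter.cofinite.limsup_set_eq] at h0
    rw [ae_iff]
    exact h0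
  have h2 := (ae_restrict_iUnion_iff (μ := volume) (fun j : ℤ => Set.Ioc (j • c) ((j + 1) • c))
    (fun ξ => {m : ℤ | ξ + m * c ∈ s}.Finite)).mpr key
  rwa [iUnion_Ioc_zsmul hc, Measure.restrict_univ] at h2

variable {T : ℝ}

/-- The values of 𝓕 f on the lattice ξ + ℤ/T are the Fourier coefficients of the T-periodization of
e^{-2πixξ} f(x). -/
theorem integral_mul_fourier_eq (f : ℝ → ℂ) (ξ : ℝ) (m : ℤ) :
    ∫ x : ℝ, Complex.exp (((-2 * Real.pi * x * ξ : ℝ) : ℂ) * Complex.I) * f x *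
      fourier m (x : AddCircle T) = 𝓕 f (ξ + ((-m : ℤ) : ℝ) * T⁻¹) := by
  rw [Real.fourier_real_eq_integral_exp_smul]
  congr 1
  ext x
  rw [fourier_coe_apply, smul_eq_mul, mul_right_comm, ← Complex.exp_add]
  congr 2
  push_cast
  field_simp
  ring

variable [hT : Fact (0 < T)]

/-- Multiplication by a power of the circle variable turns a trigonometric polynomial into an
ordinary one, which cannot have infinitely many roots unless it is zero. -/
theorem eq_zero_of_sum_fourier_eq_zero (S : Finset ℤ) (q : ℤ → ℂ) {E : Set (AddCircle T)}
    (hE : E.Infinite) (h : ∀ y ∈ E, ∑ m ∈ S, q m * fourier m y = 0) : ∀ m ∈ S, q m = 0 := by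
  obtain ⟨N, hN⟩ : ∃ N : ℕ, ∀ m ∈ S, 0 ≤ m + N := by
    obtain ⟨b, hb⟩ := S.finite_toSet.bddBelow
    exact ⟨b.natAbs, fun m hm => by have := hb hm; omega⟩
  let P : Polynomial ℂ := ∑ m ∈ S, Polynomial.C (q m) * Polynomial.X ^ (m + N).toNat
  have hroot : ∀ y ∈ E, P.eval ((AddCircle.toCircle y : Circle) : ℂ) = 0 := by
    intro y hy
    have h1 : P.eval ((AddCircle.toCircle y : Circle) : ℂ) =
        ((AddCircle.toCircle y : Circle) : ℂ) ^ N * ∑ m ∈ S, q m * fourier m y := by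
      simp only [P, Polynomial.eval_finsetSum, Polynomial.eval_mul, Polynomial.eval_C,
        Polynomial.eval_pow, Polynomial.eval_X, Finset.mul_sum]
      refine Finset.sum_congr rfl fun m hm => ?_
      have hne : ((AddCircle.toCircle y : Circle) : ℂ) ≠ 0 := Circle.coe_ne_zero _
      rw [fourier_apply, AddCircle.toCircle_zsmul, Circle.coe_zpow, ← zpow_natCast,
        Int.toNat_of_nonneg (hN m hm), zpow_add₀ hne, zpow_natCast]
      ring
    rw [h1, h y hy, mul_zero]
  have hP : P = 0 := by
    refine Polynomial.eq_zero_of_infinite_isRoot P (Set.Infinite.mono ?_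
      (hE.image (f := fun y => ((AddCircle.toCircle y : Circle) : ℂ)) ?_))
    · rintro _ ⟨y, hy, rfl⟩
      exact hroot y hy
    · intro a _ b _ hab
      exact AddCircle.injective_toCircle hT.out.ne' (Circle.ext hab)
  intro m hm
  have h2 : P.coeff (m + N).toNat = q m := by
    simp only [P, Polynomial.finsetSum_coeff, Polynomial.coeff_C_mul, Polynomial.coeff_X_pow]
    rw [Finset.sum_eq_single m]
    · simp
    · intro b hb hbm
      have : (m + N).toNat ≠ (b + N).toNat := by
        have := hN m hm; have := hN b hb; omega
      simp [this]
    · exact fun h => absurd hm h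
  rw [← h2, hP, Polynomial.coeff_zero]

/-- Together with the next lemma this says that the image of the complex measure h dx on the circle
has density `Q`, given equal Fourier coefficients. For continuous test functions it follows from
density of the span of the characters in sup norm. -/
theorem integral_mul_continuousMap_eq {h : ℝ → ℂ} (hh : Integrable h) {Q : C(AddCircle T, ℂ)}
    (hQ : ∀ m : ℤ, ∫ x : ℝ, h x * fourier m (x : AddCircle T) =
      ∫ y, Q y * fourier m y ∂AddCircle.haarAddCircle) (p : C(AddCircle T, ℂ)) :
    ∫ x : ℝ, h x * p (x : AddCircle T) = ∫ y, Q y * p y ∂AddCircle.haarAddCircle := by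
  have hmk : Continuous fun x : ℝ => (x : AddCircle T) := AddCircle.continuous_mk' T
  have hi1 : ∀ p : C(AddCircle T, ℂ), Integrable fun x : ℝ => h x * p (x : AddCircle T) := fun p =>
    hh.mul_bdd (c := ‖p‖) (p.continuous.comp hmk).aestronglyMeasurable
      (ae_of_all _ fun x => p.norm_coe_le_norm _)
  have hi2 : ∀ p : C(AddCircle T, ℂ), Integrable (fun y => Q y * p y)
      (AddCircle.haarAddCircle (T := T)) := fun p =>
    ((Q * p).continuous.integrable_of_hasCompactSupport (HasCompactSupport.of_compactSpace _))
  let L : C(AddCircle T, ℂ) →ₗ[ℂ] ℂ :=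
    { toFun := fun p => (∫ x : ℝ, h x * p (x : AddCircle T)) -
        ∫ y, Q y * p y ∂AddCircle.haarAddCircle
      map_add' := fun p₁ p₂ => by
        simp only [ContinuousMap.add_apply, mul_add]
        rw [integral_add (hi1 p₁) (hi1 p₂), integral_add (hi2 p₁) (hi2 p₂)]
        ring
      map_smul' := fun c p => by
        simp only [ContinuousMap.smul_apply, smul_eq_mul, mul_left_comm _ c, RingHom.id_apply]
        rw [integral_const_mul, integral_const_mul]
        ring }
  have hL : ∀ p, ‖L p‖ ≤ ((∫ x, ‖h x‖) + ‖Q‖) * ‖p‖ := by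
    intro p
    rw [add_mul]
    refine (norm_sub_le _ _).trans (add_le_add ?_ ?_)
    · rw [← integral_mul_const]
      refine norm_integral_le_of_norm_le (hh.norm.mul_const _) (ae_of_all _ fun x => ?_)
      rw [norm_mul]
      exact mul_le_mul_of_nonneg_left (p.norm_coe_le_norm _) (norm_nonneg _)
    · refine (norm_integral_le_of_norm_le_const (C := ‖Q‖ * ‖p‖) (ae_of_all _ fun y => ?_)).trans ?_
      · rw [norm_mul]
        exact mul_le_mul (Q.norm_coe_le_norm _) (p.norm_coe_le_norm _) (norm_nonneg _)
          (norm_nonneg _)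
      · simp
  let L' := L.mkContinuous _ hL
  have hker : LinearMap.ker (L' : C(AddCircle T, ℂ) →ₗ[ℂ] ℂ) = ⊤ := by
    rw [eq_top_iff, ← span_fourier_closure_eq_top (T := T)]
    refine Submodule.topologicalClosure_minimal _ ?_ L'.isClosed_ker
    rw [Submodule.span_le]
    rintro _ ⟨m, rfl⟩
    change (∫ x : ℝ, h x * fourier m (x : AddCircle T)) -
        ∫ y, Q y * fourier m y ∂AddCircle.haarAddCircle = 0
    rw [hQ, sub_self]
  have : p ∈ LinearMap.ker (L' : C(AddCircle T, ℂ) →ₗ[ℂ] ℂ) := by rw [hker]; trivial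
  exact sub_eq_zero.mp this

theorem integral_mul_bounded_eq {h : ℝ → ℂ} (hh : Integrable h) {Q : C(AddCircle T, ℂ)}
    (hQ : ∀ m : ℤ, ∫ x : ℝ, h x * fourier m (x : AddCircle T) =
      ∫ y, Q y * fourier m y ∂AddCircle.haarAddCircle) {p : AddCircle T → ℂ} (hp : Measurable p)
    {C : ℝ} (hC : ∀ y, ‖p y‖ ≤ C) :
    ∫ x : ℝ, h x * p (x : AddCircle T) = ∫ y, Q y * p y ∂AddCircle.haarAddCircle := by
  have hmk : Measurable fun x : ℝ => (x : AddCircle T) := AddCircle.measurable_mk'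
  have hdens : AEMeasurable (fun x => ‖h x‖ₑ) volume := hh.1.enorm
  let μ₁ : Measure (AddCircle T) := Measure.map (fun x : ℝ => (x : AddCircle T))
    (volume.withDensity fun x => ‖h x‖ₑ)
  have hfin : IsFiniteMeasure (volume.withDensity fun x => ‖h x‖ₑ) :=
    isFiniteMeasure_withDensity hh.2.ne
  have hfin1 : IsFiniteMeasure μ₁ := Measure.isFiniteMeasure_map _ _
  -- Approximating `p` in L¹ of this sum controls both sides at once: `μ₁` is the image of |h| dx,
  -- and the other side is Haar measure with the bounded density `Q`.
  let μ := μ₁ + AddCircle.haarAddCircle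
  have hpi : Integrable p μ := Integrable.of_bound hp.aestronglyMeasurable C (ae_of_all _ hC)
  have hb : ∀ ε : ℝ≥0∞, ε ≠ 0 → ‖(∫ x : ℝ, h x * p (x : AddCircle T)) -
      ∫ y, Q y * p y ∂AddCircle.haarAddCircle‖ₑ ≤ (1 + ‖Q‖ₑ) * ε := by
    intro ε hε
    obtain ⟨g, hg, -⟩ := hpi.exists_boundedContinuous_lintegral_sub_le hε
    have hgeq := integral_mul_continuousMap_eq hh hQ g.toContinuousMap
    have hInt1 : Integrable fun x : ℝ => h x * p (x : AddCircle T) :=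
      hh.mul_bdd (c := C) (hp.comp hmk).aestronglyMeasurable (ae_of_all _ fun x => hC _)
    have hInt2 : Integrable fun x : ℝ => h x * g (x : AddCircle T) :=
      hh.mul_bdd (c := ‖g‖) (g.continuous.measurable.comp hmk).aestronglyMeasurable
        (ae_of_all _ fun x => g.norm_coe_le_norm _)
    have hQi : Integrable Q (AddCircle.haarAddCircle (T := T)) :=
      Q.continuous.integrable_of_hasCompactSupport (HasCompactSupport.of_compactSpace _)
    have hInt3 : Integrable (fun y => Q y * p y) (AddCircle.haarAddCircle (T := T)) :=
      hQi.mul_bdd (c := C) hp.aestronglyMeasurable (ae_of_all _ hC)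
    have hInt4 : Integrable (fun y => Q y * g y) (AddCircle.haarAddCircle (T := T)) :=
      hQi.mul_bdd (c := ‖g‖) g.continuous.aestronglyMeasurable
        (ae_of_all _ fun x => g.norm_coe_le_norm _)
    have e : (∫ x : ℝ, h x * p (x : AddCircle T)) - ∫ y, Q y * p y ∂AddCircle.haarAddCircle =
        (∫ x : ℝ, h x * (p (x : AddCircle T) - g (x : AddCircle T))) -
          ∫ y, Q y * (p y - g y) ∂AddCircle.haarAddCircle := by
      simp only [mul_sub]
      rw [integral_sub hInt1 hInt2, integral_sub hInt3 hInt4]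
      have : ∫ x : ℝ, h x * g (x : AddCircle T) = ∫ y, Q y * g y ∂AddCircle.haarAddCircle := hgeq
      rw [this]
      ring
    have hm : Measurable fun y => ‖p y - g y‖ₑ := (hp.sub g.continuous.measurable).enorm
    rw [lintegral_add_measure] at hg
    have h1 : ‖∫ x : ℝ, h x * (p (x : AddCircle T) - g (x : AddCircle T))‖ₑ ≤ ε := by
      refine (enorm_integral_le_lintegral_enorm _).trans (le_trans (le_of_eq ?_)
        (le_self_add.trans hg))
      rw [lintegral_map hm hmk, lintegral_withDensity_eq_lintegral_mul₀ hdens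
        (g := fun x : ℝ => ‖p (x : AddCircle T) - g (x : AddCircle T)‖ₑ) (hm.comp hmk).aemeasurable]
      simp only [enorm_mul, Pi.mul_apply]
    have h2 : ‖∫ y, Q y * (p y - g y) ∂AddCircle.haarAddCircle‖ₑ ≤ ‖Q‖ₑ * ε := by
      refine (enorm_integral_le_lintegral_enorm _).trans ?_
      calc ∫⁻ y, ‖Q y * (p y - g y)‖ₑ ∂AddCircle.haarAddCircle
          ≤ ∫⁻ y, ‖Q‖ₑ * ‖p y - g y‖ₑ ∂AddCircle.haarAddCircle := by
            refine lintegral_mono fun y => ?_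
            rw [enorm_mul]
            gcongr
            rw [enorm_le_iff_norm_le]
            exact Q.norm_coe_le_norm y
        _ = ‖Q‖ₑ * ∫⁻ y, ‖p y - g y‖ₑ ∂AddCircle.haarAddCircle := lintegral_const_mul _ hm
        _ ≤ _ := by gcongr; exact le_add_self.trans hg
    rw [e, add_mul, one_mul]
    exact enorm_sub_le.trans (add_le_add h1 h2)
  have hz : ‖(∫ x : ℝ, h x * p (x : AddCircle T)) -
      ∫ y, Q y * p y ∂AddCircle.haarAddCircle‖ₑ = 0 := by
    by_contra hne
    set d := ‖(∫ x : ℝ, h x * p (x : AddCircle T)) -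
      ∫ y, Q y * p y ∂AddCircle.haarAddCircle‖ₑ with hd
    have hdt : d ≠ ∞ := enorm_ne_top
    have hq : 1 + ‖Q‖ₑ ≠ ∞ := by simp
    have h1 := hb (d / 2 / (1 + ‖Q‖ₑ)) (ENNReal.div_ne_zero.mpr
      ⟨ENNReal.div_ne_zero.mpr ⟨hne, by norm_num⟩, hq⟩)
    rw [ENNReal.mul_div_cancel (by simp) hq] at h1
    exact absurd h1 (not_le.mpr (ENNReal.half_lt_self hne hdt))
  exact sub_eq_zero.mp (enorm_eq_zero.mp hz)


theorem haarAddCircle_finite {E : Set (AddCircle T)} (hE : E.Finite) :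
    AddCircle.haarAddCircle E = 0 := by
  have h1 : volume E = 0 := by
    rw [AddCircle.add_projection_respects_measure T 0 hE.measurableSet]
    refine Set.Finite.measure_zero (Set.Finite.of_finite_image (f := fun x : ℝ => (x : AddCircle T))
      (hE.subset ?_) ?_) _
    · rintro _ ⟨x, hx, rfl⟩
      exact hx.1
    · intro a ha b hb hab
      exact (AddCircle.coe_eq_coe_iff_of_mem_Ioc ha.2 hb.2).mp hab
  rw [AddCircle.volume_eq_smul_haarAddCircle, Measure.smul_apply, smul_eq_mul, mul_eq_zero] at h1
  exact h1.resolve_left (by simpa using hT.out)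

/-- Folding `A` onto the circle does not increase its measure, so it cannot fill a circle of length
T > |A|; the complement of the folded set is the desired `E`. -/
theorem exists_circle_set {A : Set ℝ} (hAm : MeasurableSet A)
    (hA : volume A < ENNReal.ofReal T) : ∃ E : Set (AddCircle T), MeasurableSet E ∧
      AddCircle.haarAddCircle E ≠ 0 ∧ ∀ x ∈ A, (x : AddCircle T) ∉ E := by
  let D : Set ℝ := ⋃ m : ℤ, (fun x : ℝ => x + m • T) ⁻¹' A
  have hDm : MeasurableSet D := MeasurableSet.iUnion fun m => (measurable_add_const _) hAm
  let ι : AddCircle T → ℝ := fun y => (AddCircle.measurableEquivIoc T 0 y : ℝ)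
  have hι : Measurable ι := measurable_subtype_coe.comp
      (AddCircle.measurableEquivIoc T 0).measurable
  have hιmk : ∀ y, ((ι y : ℝ) : AddCircle T) = y := fun y =>
    (AddCircle.measurableEquivIoc T 0).symm_apply_apply y
  have hmkι : ∀ x ∈ Set.Ioc (0 : ℝ) (0 + T), ι (x : AddCircle T) = x := fun x hx =>
    congrArg Subtype.val ((AddCircle.measurableEquivIoc T 0).apply_symm_apply ⟨x, hx⟩)
  have hDsmall : volume (D ∩ Set.Ioc (0 : ℝ) (0 + T)) ≤ volume A := by
    have h1 : ∀ m : ℤ, volume ((fun x : ℝ => x + m • T) ⁻¹' A ∩ Set.Ioc (0 : ℝ) (0 + T)) =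
        volume (A ∩ Set.Ioc (0 + m • T) (0 + (m + 1) • T)) := by
      intro m
      rw [← measure_preimage_add_right volume (m • T) (A ∩ _)]
      congr 1
      ext x
      simp only [Set.mem_inter_iff, Set.mem_preimage, Set.mem_Ioc, zsmul_eq_mul]
      push_cast
      refine and_congr_right fun _ => and_congr ⟨fun h => by linarith, fun h => by linarith⟩
        ⟨fun h => by linarith, fun h => by linarith⟩
    rw [Set.iUnion_inter]
    refine (measure_iUnion_le _).trans ?_
    simp_rw [h1]
    rw [← measure_iUnion _ fun m => hAm.inter measurableSet_Ioc]
    · exact measure_mono (Set.iUnion_subset fun m => Set.inter_subset_left)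
    · intro a b hab
      exact ((Set.pairwise_disjoint_Ioc_add_zsmul (0 : ℝ) T) hab).mono Set.inter_subset_right
        Set.inter_subset_right
  refine ⟨ι ⁻¹' Dᶜ, hι hDm.compl, ?_, fun x hx hmem => hmem ?_⟩
  · intro h0
    have h1 : volume (ι ⁻¹' Dᶜ) = 0 := by
      rw [AddCircle.volume_eq_smul_haarAddCircle, Measure.smul_apply, h0, smul_zero]
    rw [AddCircle.add_projection_respects_measure T 0 (hι hDm.compl)] at h1
    have h2 : Set.Ioc (0 : ℝ) (0 + T) ⊆
        ((fun x : ℝ => (x : AddCircle T)) ⁻¹' (ι ⁻¹' Dᶜ) ∩ Set.Ioc (0 : ℝ) (0 + T)) ∪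
          (D ∩ Set.Ioc (0 : ℝ) (0 + T)) := by
      intro x hx
      by_cases hxD : x ∈ D
      · exact Or.inr ⟨hxD, hx⟩
      · refine Or.inl ⟨?_, hx⟩
        change ι (x : AddCircle T) ∉ D
        rwa [hmkι x hx]
    have h3 := (measure_mono (μ := volume) h2).trans (measure_union_le _ _)
    have h4 : volume ((fun x : ℝ => (x : AddCircle T)) ⁻¹' (ι ⁻¹' Dᶜ) ∩ Set.Ioc (0 : ℝ)
        (0 + T)) = 0 := h1
    rw [h4, zero_add (volume _), Real.volume_Ioc] at h3
    rw [zero_add] at h3 hDsmall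
    have h5 := h3.trans hDsmall
    rw [sub_zero] at h5
    exact absurd hA (not_lt.mpr h5)
  · have h1 : ((ι (x : AddCircle T) : ℝ) : AddCircle T) = (x : AddCircle T) := hιmk _
    rw [← sub_eq_zero, ← AddCircle.coe_sub, AddCircle.coe_eq_zero_iff] at h1
    obtain ⟨m, hm⟩ := h1
    refine Set.mem_iUnion.mpr ⟨-m, ?_⟩
    rw [Set.mem_preimage, neg_smul, hm, ← sub_eq_add_neg, sub_sub_cancel]
    exact hx

/-- For almost every ξ only finitely many lattice points ξ + m/T lie in `s`, so the periodization of
e^{-2πixξ} f is a trigonometric polynomial `Q`. It vanishes on a set of positive measure, the part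
of the circle missed by `A`, hence has infinitely many zeros and is zero. Its coefficient at m = 0
is 𝓕 f(ξ). -/
theorem fourier_ae_eq_zero {f : ℝ → ℂ} (hf : Integrable f) {A s : Set ℝ} (hAm : MeasurableSet A)
    (hA : volume A ≠ ∞) (hfA : ∀ x, x ∉ A → f x = 0) (hsm : MeasurableSet s)
    (hs : volume s ≠ ∞) (hfs : ∀ᵐ ξ, ξ ∉ s → 𝓕 f ξ = 0) : ∀ᵐ ξ, 𝓕 f ξ = 0 := by
  let T : ℝ := (volume A).toReal + 1
  have hTpos : 0 < T := by positivity
  have hT : Fact (0 < T) := ⟨hTpos⟩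
  have hAT : volume A < ENNReal.ofReal T := by
    rw [← ENNReal.ofReal_toReal hA]
    exact (ENNReal.ofReal_lt_ofReal_iff hTpos).mpr (by simp [T])
  obtain ⟨E, hEm, hE0, hEA⟩ := exists_circle_set hAm hAT
  have hEinf : ∀ E' : Set (AddCircle T), AddCircle.haarAddCircle E' ≠ 0 → E'.Infinite := by
    intro E' h hfin
    exact h (haarAddCircle_finite hfin)
  have hall : ∀ᵐ ξ : ℝ, ∀ m : ℤ, ξ + m * T⁻¹ ∉ s → 𝓕 f (ξ + m * T⁻¹) = 0 := by
    rw [ae_all_iff]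
    intro m
    exact (measurePreserving_add_right volume ((m : ℝ) * T⁻¹)).quasiMeasurePreserving.ae hfs
  filter_upwards [ae_finite_translates hsm hs (inv_pos.mpr hTpos), hall] with ξ hfin hξ
  let S : Finset ℤ := hfin.toFinset
  have hS : ∀ m, m ∉ S → 𝓕 f (ξ + m * T⁻¹) = 0 := fun m hm => hξ m (by simpa [S] using hm)
  let Q : C(AddCircle T, ℂ) := ∑ m ∈ S, 𝓕 f (ξ + m * T⁻¹) • fourier m
  have hQapp : ∀ y, Q y = ∑ m ∈ S, 𝓕 f (ξ + m * T⁻¹) * fourier m y := fun y => by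
    simp [Q]
  let h : ℝ → ℂ := fun x => Complex.exp (((-2 * Real.pi * x * ξ : ℝ) : ℂ) * Complex.I) * f x
  have hh : Integrable h := by
    refine hf.bdd_mul (c := 1) (Continuous.aestronglyMeasurable (by fun_prop))
      (ae_of_all _ fun x => ?_)
    rw [Complex.norm_exp_ofReal_mul_I]
  have hQ : ∀ m : ℤ, ∫ x : ℝ, h x * fourier m (x : AddCircle T) =
      ∫ y, Q y * fourier m y ∂AddCircle.haarAddCircle := by
    intro m
    rw [integral_mul_fourier_eq]
    have h1 : ∫ y, Q y * fourier m y ∂AddCircle.haarAddCircle = fourierCoeff Q (-m) := by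
      rw [fourierCoeff, neg_neg]
      simp [mul_comm]
    rw [h1]
    have h2 : fourierCoeff (Q : AddCircle T → ℂ) (-m) =
        ∑ j ∈ S, 𝓕 f (ξ + j * T⁻¹) * (Pi.single j 1 : ℤ → ℂ) (-m) := by
      have : (Q : AddCircle T → ℂ) = ∑ j ∈ S, fun y => 𝓕 f (ξ + j * T⁻¹) * fourier j y := by
        ext y; rw [hQapp, Finset.sum_apply]
      rw [this, fourierCoeff.sum]
      · simp only [Finset.sum_apply, fourierCoeff.const_mul, fourierCoeff_fourier]
      · intro j _
        exact ((fourier j).continuous.integrable_of_hasCompactSupport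
          (HasCompactSupport.of_compactSpace _)).const_mul _
    rw [h2]
    by_cases hm : -m ∈ S
    · rw [Finset.sum_eq_single (-m)]
      · simp
      · intro b _ hb; simp [hb.symm]
      · exact fun h => absurd hm h
    · rw [hS _ hm, Finset.sum_eq_zero]
      intro b hb
      have : -m ≠ b := fun h => hm (h ▸ hb)
      simp [this]
  -- Testing the density identity against 1_E times the conjugate of `Q` gives ∫_E |Q|² = 0, because
  -- f vanishes wherever the projected point lies in `E`.
  let p : AddCircle T → ℂ := E.indicator fun y => (starRingEnd ℂ) (Q y)
  have hp : Measurable p := (Complex.continuous_conj.comp Q.continuous).measurable.indicator hEm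
  have hpC : ∀ y, ‖p y‖ ≤ ‖Q‖ := fun y =>
    (norm_indicator_le_norm_self _ _).trans (by simpa using Q.norm_coe_le_norm y)
  have hkey := integral_mul_bounded_eq hh hQ hp hpC
  have hzero : ∫ x : ℝ, h x * p (x : AddCircle T) = 0 := by
    rw [← integral_zero ℝ ℂ]
    congr 1
    ext x
    by_cases hx : x ∈ A
    · simp [p, hEA x hx]
    · simp [h, hfA x hx]
  rw [hzero] at hkey
  have hQE : ∫ y in E, ‖Q y‖ ^ 2 ∂AddCircle.haarAddCircle = 0 := by
    rw [← integral_indicator hEm, ← Complex.ofReal_eq_zero, ← integral_complex_ofReal, hkey]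
    congr 1
    ext y
    by_cases hy : y ∈ E
    · simp [p, hy, Complex.mul_conj, Complex.normSq_eq_norm_sq]
    · simp [p, hy]
  have hQ2 : Integrable (fun y => ‖Q y‖ ^ 2) (AddCircle.haarAddCircle.restrict E) :=
    ((Q.continuous.norm.pow 2).integrable_of_hasCompactSupport
      (HasCompactSupport.of_compactSpace _)).restrict
  rw [integral_eq_zero_iff_of_nonneg (fun y => by positivity) hQ2] at hQE
  have hpos : AddCircle.haarAddCircle (E ∩ {y | Q y = 0}) ≠ 0 := by
    have h1 : AddCircle.haarAddCircle.restrict E {y | ¬ Q y = 0} = 0 := by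
      rw [← ae_iff]
      filter_upwards [hQE] with y hy
      simpa using hy
    have h2 : (E : Set (AddCircle T)) ⊆ (E ∩ {y | Q y = 0}) ∪ ({y | ¬ Q y = 0} ∩ E) := by
      intro y hy
      by_cases h : Q y = 0
      · exact Or.inl ⟨hy, h⟩
      · exact Or.inr ⟨h, hy⟩
    rw [Measure.restrict_apply (isOpen_ne_fun Q.continuous continuous_const).measurableSet] at h1
    intro h3
    exact hE0 (measure_mono_null h2 (measure_union_null h3 h1))
  have hcoef := eq_zero_of_sum_fourier_eq_zero S (fun m => 𝓕 f (ξ + m * T⁻¹)) (hEinf _ hpos)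
    (fun y hy => by rw [← hQapp]; exact hy.2)
  by_cases h0 : (0 : ℤ) ∈ S
  · simpa using hcoef 0 h0
  · simpa using hS 0 h0

/-- **Benedicks' theorem** on the line: an integrable, square integrable function which, together
with its Fourier transform, vanishes off a set of finite measure, is zero. -/
theorem ae_eq_zero_of_support_finite {f : ℝ → ℂ} (hf : Integrable f) (hf2 : MemLp f 2 volume)
    {A s : Set ℝ} (hAm : MeasurableSet A) (hA : volume A ≠ ∞) (hfA : ∀ᵐ x, x ∉ A → f x = 0)
    (hsm : MeasurableSet s) (hs : volume s ≠ ∞) (hfs : ∀ᵐ ξ, ξ ∉ s → 𝓕 f ξ = 0) :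
    f =ᵐ[volume] 0 := by
  have hae : A.indicator f =ᵐ[volume] f := by
    filter_upwards [hfA] with x hx
    by_cases h : x ∈ A
    · simp [h]
    · simp [h, hx h]
  have hF : 𝓕 (A.indicator f) = 𝓕 f := by
    ext ξ
    rw [Real.fourier_real_eq, Real.fourier_real_eq]
    refine integral_congr_ae ?_
    filter_upwards [hae] with x hx
    rw [hx]
  have h1 : ∀ᵐ ξ, 𝓕 f ξ = 0 := by
    rw [← hF] at hfs ⊢
    exact fourier_ae_eq_zero (hf.indicator hAm) hAm hA (fun x hx => by simp [hx]) hsm hs hfs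
  have h2 := eLpNorm_fourier_eq hf hf2
  rw [eLpNorm_congr_ae (g := 0) h1, eLpNorm_zero, eq_comm,
    eLpNorm_eq_zero_iff hf2.1 (by norm_num)] at h2
  exact h2

end Benedicks

/-! ### The Plancherel theorem for the normalized Strichartz Fourier transform -/

instance sFinite_nu₂ (n : ℕ) : SFinite (nu₂ n) := by
  unfold nu₂
  infer_instance

theorem lintegral_nu₂ (n : ℕ) {F : fan n → ℝ≥0∞} (hF : Measurable F) :
    ∫⁻ a, F a ∂(nu₂ n) = ∑' k, ENNReal.ofReal (((2 * Real.pi) ^ (2 * n + 1))⁻¹ *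
      ((coeff n k) ^ 2)⁻¹) * ∫⁻ l : ℝ, ENNReal.ofReal (|l| ^ (2 * n)) * F (ray n k l) := by
  rw [nu₂, lintegral_sum_measure]
  refine tsum_congr fun k => ?_
  rw [lintegral_smul_measure, lintegral_map hF (measurable_ray n k),
    lintegral_withDensity_eq_lintegral_mul _ (by fun_prop)
      (g := fun l => F (ray n k l)) (hF.comp (measurable_ray n k)), smul_eq_mul]
  rfl

theorem lintegral_specMeasure (n : ℕ) {F : fan n × (Fin n → ℂ) → ℝ≥0∞} (hF : Measurable F) :
    ∫⁻ x, F x ∂(specMeasure n) = ∫⁻ l : ℝ, ∑' k,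
      ENNReal.ofReal (((2 * Real.pi) ^ (2 * n + 1))⁻¹ * ((coeff n k) ^ 2)⁻¹) *
        (ENNReal.ofReal (|l| ^ (2 * n)) * ∫⁻ w, F (ray n k l, w)) := by
  have hm : ∀ k, Measurable fun l : ℝ =>
      ENNReal.ofReal (|l| ^ (2 * n)) * ∫⁻ w, F (ray n k l, w) := fun k =>
    Measurable.mul (by fun_prop) (hF.lintegral_prod_right'.comp (measurable_ray n k))
  rw [specMeasure, lintegral_prod _ hF.aemeasurable, lintegral_nu₂ n hF.lintegral_prod_right',
    lintegral_tsum fun k => ((hm k).const_mul _).aemeasurable]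
  exact tsum_congr fun k => (lintegral_const_mul _ (hm k)).symm

theorem exists_eq_ray {a : fan n} (ha : (a : ℝ × ℝ).1 ≠ 0) :
    ∃ k l, l ≠ 0 ∧ a = ray n k l := by
  obtain ⟨k, l, hl, h⟩ | ⟨τ, -, h⟩ := a.2
  · exact ⟨k, l, hl, Subtype.ext h⟩
  · exact absurd (by rw [h]) ha

/-- The limiting ray is null, so the Bessel branch of the transform plays no part in any L²
statement. -/
theorem ae_specMeasure_fst_ne_zero (n : ℕ) :
    ∀ᵐ x ∂(specMeasure n), (x.1 : ℝ × ℝ).1 ≠ 0 := by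
  have hm : MeasurableSet {x : fan n × (Fin n → ℂ) | ¬ (x.1 : ℝ × ℝ).1 ≠ 0} := by
    have : Measurable fun x : fan n × (Fin n → ℂ) => (x.1 : ℝ × ℝ).1 := by fun_prop
    simp only [not_not]
    exact this (measurableSet_singleton 0)
  rw [ae_iff, ← lintegral_indicator_one hm, lintegral_specMeasure n (measurable_one.indicator hm)]
  rw [← lintegral_zero (μ := (volume : Measure ℝ))]
  refine lintegral_congr_ae ?_
  have : ∀ᵐ l : ℝ, l ≠ 0 := by simp [ae_iff]
  filter_upwards [this] with l hl
  simp [Set.indicator, ray, hl]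

/-- A measurable function on the fan which gives the index of the ray. -/
def floorIndex (a : fan n) : ℕ := ⌊((a : ℝ × ℝ).2 / |(a : ℝ × ℝ).1| - n) / 2⌋₊

theorem measurable_floorIndex : Measurable (floorIndex (n := n)) := by
  unfold floorIndex
  fun_prop

theorem floorIndex_ray (k : ℕ) {l : ℝ} (hl : l ≠ 0) : floorIndex (ray n k l) = k := by
  have : |l| ≠ 0 := abs_ne_zero.mpr hl
  simp [floorIndex, ray, this]

theorem rayIndex_eq_floorIndex {a : fan n} (ha : (a : ℝ × ℝ).1 ≠ 0) :
    rayIndex a = floorIndex a := by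
  obtain ⟨k, l, hl, rfl⟩ := exists_eq_ray ha
  rw [rayIndex_ray n k hl, floorIndex_ray k hl]

/-- The integral kernel of the normalized transform off the limiting ray. -/
def kern (a : fan n) (w : Fin n → ℂ) (p : Heis n) : ℂ :=
  (coeff n (floorIndex a) : ℂ) * (Complex.exp (-(Complex.I * (a : ℝ × ℝ).1 * (p.2 : ℂ))) *
    lagKernel (floorIndex a) (a : ℝ × ℝ).1 p.1 w)

theorem normFactor_mul_eFun {a : fan n} (ha : (a : ℝ × ℝ).1 ≠ 0) (w : Fin n → ℂ) (p : Heis n) :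
    (normFactor a : ℂ) * eFun a (p.inv.mul (w, 0)) = kern a w p := by
  rw [normFactor, if_neg ha, eFun, if_neg ha, kern, rayIndex_eq_floorIndex ha, lagKernel, phase,
    ← mul_assoc (Complex.exp _) (Complex.exp _), ← Complex.exp_add]
  congr 2
  · congr 1
    simp only [Heis.mul, Heis.inv, herm, Pi.neg_apply, neg_mul, Finset.sum_neg_distrib,
      Complex.neg_im]
    push_cast
    ring
  · simp only [Heis.mul, Heis.inv, neg_add_eq_sub]

theorem transform_eq_integral_kern (f : Heis n → ℂ) {x : fan n × (Fin n → ℂ)}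
    (hx : (x.1 : ℝ × ℝ).1 ≠ 0) : transform f x = ∫ p, f p * kern x.1 x.2 p := by
  rw [transform, ← integral_const_mul]
  congr 1
  ext p
  rw [← normFactor_mul_eFun hx]
  ring

theorem norm_exp_neg_I_mul (l t : ℝ) : ‖Complex.exp (-(Complex.I * l * (t : ℂ)))‖ = 1 := by
  rw [show -(Complex.I * l * (t : ℂ)) = ((-(l * t) : ℝ) : ℂ) * Complex.I by push_cast; ring]
  exact Complex.norm_exp_ofReal_mul_I _

/-- The factor c_{n,k} exactly compensates the maximum 1/c_{n,k} of the Laguerre function. This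
uniform bound underlies the compactness argument. -/
theorem norm_kern_le (hn : 1 ≤ n) {a : fan n} (ha : (a : ℝ × ℝ).1 ≠ 0) (w : Fin n → ℂ)
    (p : Heis n) : ‖kern a w p‖ ≤ 1 := by
  have hc := coeff_pos n (floorIndex a)
  rw [kern, norm_mul, norm_mul, norm_exp_neg_I_mul, one_mul, Complex.norm_real,
    Real.norm_of_nonneg hc.le]
  calc _ ≤ coeff n (floorIndex a) * (coeff n (floorIndex a))⁻¹ :=
        mul_le_mul_of_nonneg_left (norm_lagKernel_le_coeff hn ha _ _ _) hc.le
    _ = 1 := mul_inv_cancel₀ hc.ne'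

theorem continuous_laguerreFun_uncurry (k : ℕ) :
    Continuous fun q : ℝ × (Fin n → ℂ) => laguerreFun n k q.1 q.2 := by
  unfold laguerreFun
  fun_prop

theorem measurable_kern :
    Measurable fun q : (fan n × (Fin n → ℂ)) × Heis n => kern q.1.1 q.1.2 q.2 := by
  have h1 : Measurable fun r : ℕ × (ℝ × (Fin n → ℂ) × Heis n) =>
      (coeff n r.1 : ℂ) * (Complex.exp (-(Complex.I * r.2.1 * (r.2.2.2.2 : ℂ))) *
        lagKernel r.1 r.2.1 r.2.2.2.1 r.2.2.1) := by
    refine measurable_from_prod_countable_right fun k => Continuous.measurable ?_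
    have h2 := continuous_laguerreFun_uncurry (n := n) k
    have h3 := continuous_herm (n := n)
    unfold lagKernel phase
    have h4 : Continuous fun r : ℝ × (Fin n → ℂ) × Heis n =>
        laguerreFun n k r.1 (r.2.1 - r.2.2.1) := by
      have := h2.comp (by fun_prop : Continuous fun r : ℝ × (Fin n → ℂ) × Heis n =>
        (r.1, r.2.1 - r.2.2.1))
      exact this
    have h5 : Continuous fun r : ℝ × (Fin n → ℂ) × Heis n => herm r.2.2.1 r.2.1 := by
      have := h3.comp (by fun_prop : Continuous fun r : ℝ × (Fin n → ℂ) × Heis n =>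
        (r.2.2.1, r.2.1))
      exact this
    simp only
    fun_prop
  have h6 : Measurable fun q : (fan n × (Fin n → ℂ)) × Heis n =>
      (floorIndex q.1.1, ((q.1.1 : ℝ × ℝ).1, q.1.2, q.2)) := by
    have := measurable_floorIndex (n := n)
    fun_prop
  have h7 := h1.comp h6
  unfold kern
  exact h7

theorem stronglyMeasurable_integral_kern {f : Heis n → ℂ} (hf : StronglyMeasurable f) :
    StronglyMeasurable fun x : fan n × (Fin n → ℂ) => ∫ p, f p * kern x.1 x.2 p := by
  refine StronglyMeasurable.integral_prod_right
    (f := fun (x : fan n × (Fin n → ℂ)) p => f p * kern x.1 x.2 p) ?_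
  exact (hf.comp_measurable measurable_snd).mul measurable_kern.stronglyMeasurable

theorem transform_ae_eq (f : Heis n → ℂ) :
    transform f =ᵐ[specMeasure n] fun x => ∫ p, f p * kern x.1 x.2 p := by
  filter_upwards [ae_specMeasure_fst_ne_zero n] with x hx
  exact transform_eq_integral_kern f hx

/-! ### Fourier transform in the central variable and the Plancherel identity -/

/-- The Fourier transform in the central variable. -/
def centralFourier (f : Heis n → ℂ) (l : ℝ) (z : Fin n → ℂ) : ℂ :=
  ∫ t : ℝ, f (z, t) * Complex.exp (-(Complex.I * l * (t : ℂ)))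

open scoped FourierTransform in
theorem centralFourier_eq_fourier (f : Heis n → ℂ) (l : ℝ) (z : Fin n → ℂ) :
    centralFourier f l z = 𝓕 (fun t => f (z, t)) ((2 * Real.pi)⁻¹ * l) := by
  rw [Real.fourier_real_eq_integral_exp_smul, centralFourier]
  congr 1
  ext t
  rw [smul_eq_mul, mul_comm]
  congr 2
  push_cast
  field_simp

theorem integrable_mul_exp {f : Heis n → ℂ} (hf : Integrable f) (l : ℝ) :
    Integrable fun p : Heis n => f p * Complex.exp (-(Complex.I * l * (p.2 : ℂ))) :=
  hf.mul_bdd (c := 1) (Continuous.aestronglyMeasurable (by fun_prop))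
    (ae_of_all _ fun p => (norm_exp_neg_I_mul l p.2).le)

theorem integrable_centralFourier {f : Heis n → ℂ} (hf : Integrable f) (l : ℝ) :
    Integrable (centralFourier f l) :=
  (integrable_mul_exp hf l).integral_prod_left

theorem integral_kern_ray (hn : 1 ≤ n) {f : Heis n → ℂ} (hf : Integrable f) (k : ℕ) {l : ℝ}
    (hl : l ≠ 0) (w : Fin n → ℂ) :
    ∫ p, f p * kern (ray n k l) w p = (coeff n k : ℂ) * twConv k l (centralFourier f l) w := by
  have hInt : Integrable fun p : Heis n => f p * kern (ray n k l) w p := by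
    refine hf.mul_bdd (c := 1) ?_ (ae_of_all _ fun p => norm_kern_le hn hl w p)
    exact (measurable_kern.comp (measurable_prodMk_left (x := (ray n k l, w)))).aestronglyMeasurable
  rw [Measure.volume_eq_prod, integral_prod _ hInt, twConv, ← integral_const_mul]
  congr 1
  ext z
  rw [centralFourier, ← integral_mul_const, ← integral_const_mul]
  congr 1
  ext t
  rw [kern, floorIndex_ray k hl]
  simp only [ray]
  ring

theorem stronglyMeasurable_centralFourier {f : Heis n → ℂ} (hf : StronglyMeasurable f) :
    StronglyMeasurable fun q : ℝ × (Fin n → ℂ) => centralFourier f q.1 q.2 := by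
  refine StronglyMeasurable.integral_prod_right (f := fun (q : ℝ × (Fin n → ℂ)) (t : ℝ) =>
    f (q.2, t) * Complex.exp (-(Complex.I * q.1 * (t : ℂ)))) ?_
  refine StronglyMeasurable.mul (hf.comp_measurable (g := fun r : (ℝ × (Fin n → ℂ)) × ℝ =>
    (r.1.2, r.2)) (by fun_prop)) (Continuous.stronglyMeasurable ?_)
  fun_prop

theorem eLpNorm_two_sq {α : Type*} {m : MeasurableSpace α} {μ : Measure α} (f : α → ℂ) :
    eLpNorm f 2 μ ^ 2 = ∫⁻ x, ‖f x‖ₑ ^ 2 ∂μ := by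
  have := eLpNorm_nnreal_pow_eq_lintegral (f := f) (μ := μ) (p := 2) (by norm_num)
  simpa using this

theorem memLp_two_of_lintegral {α : Type*} {m : MeasurableSpace α} {μ : Measure α} {f : α → ℂ}
    (hf : AEStronglyMeasurable f μ) (h : ∫⁻ x, ‖f x‖ₑ ^ 2 ∂μ < ∞) : MemLp f 2 μ := by
  rw [← eLpNorm_two_sq] at h
  exact ⟨hf, (ENNReal.pow_lt_top_iff.mp h).resolve_right (by norm_num)⟩

/-- Plancherel on the line for almost every slice t ↦ f(z,t); the factor 2π comes from the frequency
change λ = 2πξ. -/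
theorem lintegral_centralFourier {f : Heis n → ℂ} (hfm : StronglyMeasurable f) (hf : Integrable f)
    (hf2 : MemLp f 2 volume) :
    ∫⁻ l : ℝ, ∫⁻ z, ‖centralFourier f l z‖ₑ ^ 2 =
      ENNReal.ofReal (2 * Real.pi) * ∫⁻ p, ‖f p‖ₑ ^ 2 := by
  have hm := (stronglyMeasurable_centralFourier hfm).enorm.pow_const 2
  rw [lintegral_lintegral_swap hm.aemeasurable, Measure.volume_eq_prod,
    lintegral_prod _ (hfm.enorm.pow_const 2).aemeasurable, ← lintegral_const_mul _
      (hfm.enorm.pow_const 2).lintegral_prod_right']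
  refine lintegral_congr_ae ?_
  have h1 : ∀ᵐ z : Fin n → ℂ, Integrable fun t => f (z, t) := hf.prod_right_ae
  have h2 : ∀ᵐ z : Fin n → ℂ, ∫⁻ t, ‖f (z, t)‖ₑ ^ 2 < ∞ := by
    refine ae_lt_top (hfm.enorm.pow_const 2).lintegral_prod_right' ?_
    rw [← lintegral_prod _ (hfm.enorm.pow_const 2).aemeasurable, ← Measure.volume_eq_prod,
      ← eLpNorm_two_sq]
    exact ENNReal.pow_ne_top hf2.eLpNorm_ne_top
  filter_upwards [h1, h2] with z hz1 hz2
  have hz3 : MemLp (fun t => f (z, t)) 2 volume :=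
    memLp_two_of_lintegral hz1.1 hz2
  have h3 := congrArg (· ^ 2) (eLpNorm_fourier_eq hz1 hz3)
  simp only [eLpNorm_two_sq] at h3
  rw [← h3]
  simp_rw [centralFourier_eq_fourier]
  have hpi : (0 : ℝ) < 2 * Real.pi := by positivity
  have h4 : Measurable fun ξ => ‖FourierTransform.fourier (fun t => f (z, t)) ξ‖ₑ ^ 2 :=
    (continuous_fourier hz1).measurable.enorm.pow_const 2
  rw [← lintegral_map h4 (measurable_const_mul (2 * Real.pi)⁻¹),
    Real.map_volume_mul_left (inv_ne_zero hpi.ne'), lintegral_smul_measure, inv_inv,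
    abs_of_pos hpi, smul_eq_mul]

theorem lintegral_integral_kern (hn : 1 ≤ n) {f : Heis n → ℂ} (hfm : StronglyMeasurable f)
    (hf : Integrable f) (hf2 : MemLp f 2 volume) :
    ∫⁻ x, ‖∫ p, f p * kern x.1 x.2 p‖ₑ ^ 2 ∂(specMeasure n) = ∫⁻ p, ‖f p‖ₑ ^ 2 := by
  have hm := (stronglyMeasurable_integral_kern hfm).enorm.pow_const 2
  have hm2 := (stronglyMeasurable_centralFourier hfm).enorm.pow_const 2
  have hcent := lintegral_centralFourier hfm hf hf2
  have hne : ∫⁻ p, ‖f p‖ₑ ^ 2 ≠ ∞ := by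
    rw [← eLpNorm_two_sq]; exact ENNReal.pow_ne_top hf2.eLpNorm_ne_top
  have hfin : ∀ᵐ l : ℝ, ∫⁻ z, ‖centralFourier f l z‖ₑ ^ 2 < ∞ := by
    refine ae_lt_top hm2.lintegral_prod_right' ?_
    rw [hcent]
    exact ENNReal.mul_ne_top ENNReal.ofReal_ne_top hne
  have hl0 : ∀ᵐ l : ℝ, l ≠ 0 := by simp [ae_iff]
  have key : ∀ᵐ l : ℝ, ∑' k,
      ENNReal.ofReal (((2 * Real.pi) ^ (2 * n + 1))⁻¹ * ((coeff n k) ^ 2)⁻¹) *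
        (ENNReal.ofReal (|l| ^ (2 * n)) *
          ∫⁻ w, ‖∫ p, f p * kern (ray n k l) w p‖ₑ ^ 2) =
      ENNReal.ofReal (2 * Real.pi)⁻¹ * ∫⁻ z, ‖centralFourier f l z‖ₑ ^ 2 := by
    filter_upwards [hfin, hl0] with l hl hl0
    have hg := integrable_centralFourier hf l
    have hg2 : MemLp (centralFourier f l) 2 volume :=
      memLp_two_of_lintegral hg.1 hl
    have hl1 : |l| ≠ 0 := abs_ne_zero.mpr hl0
    -- The weight c_{n,k}^{-2} of ν₂ cancels the square of the normalizing factor, so the sum over k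
    -- becomes the Plancherel sum at fixed λ; |λ|^{2n} then cancels (2π/|λ|)^{2n} up to powers of
    -- 2π.
    have hterm : ∀ k, ENNReal.ofReal (((2 * Real.pi) ^ (2 * n + 1))⁻¹ * ((coeff n k) ^ 2)⁻¹) *
        (ENNReal.ofReal (|l| ^ (2 * n)) *
          ∫⁻ w, ‖∫ p, f p * kern (ray n k l) w p‖ₑ ^ 2) =
        ENNReal.ofReal (((2 * Real.pi) ^ (2 * n + 1))⁻¹ * |l| ^ (2 * n)) *
          ∫⁻ w, ‖twConv k l (centralFourier f l) w‖ₑ ^ 2 := by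
      intro k
      have hc := coeff_pos n k
      simp_rw [integral_kern_ray hn hf k hl0, enorm_mul, mul_pow]
      rw [lintegral_const_mul' _ _ (by simp), ← ofReal_norm, Complex.norm_real,
        Real.norm_of_nonneg hc.le, ← ENNReal.ofReal_pow hc.le, ← mul_assoc, ← mul_assoc,
        ← ENNReal.ofReal_mul (by positivity), ← ENNReal.ofReal_mul (by positivity)]
      congr 2
      field_simp
    simp_rw [hterm]
    rw [ENNReal.tsum_mul_left, tsum_lintegral_twConv hn hl0 hg hg2, ← mul_assoc,
      ← ENNReal.ofReal_mul (by positivity)]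
    congr 2
    rw [div_pow]
    field_simp
    ring
  rw [lintegral_specMeasure n hm, lintegral_congr_ae key, lintegral_const_mul' _ _ (by simp), hcent,
    ← mul_assoc, ← ENNReal.ofReal_mul (by positivity), inv_mul_cancel₀ (by positivity),
    ENNReal.ofReal_one, one_mul]

theorem memLp_transform (hn : 1 ≤ n) {f : Heis n → ℂ} (hfm : StronglyMeasurable f)
    (hf : Integrable f) (hf2 : MemLp f 2 volume) :
    MemLp (transform f) 2 (specMeasure n) ∧
      eLpNorm (transform f) 2 (specMeasure n) = eLpNorm f 2 volume := by
  have he : eLpNorm (transform f) 2 (specMeasure n) = eLpNorm f 2 volume := by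
    rw [eLpNorm_congr_ae (transform_ae_eq f)]
    refine (ENNReal.pow_right_strictMono (n := 2) (by norm_num)).injective ?_
    simp only [eLpNorm_two_sq]
    exact lintegral_integral_kern hn hfm hf hf2
  refine ⟨⟨?_, he ▸ hf2.2⟩, he⟩
  exact (stronglyMeasurable_integral_kern hfm).aestronglyMeasurable.congr (transform_ae_eq f).symm

/-! ### The extension of the transform to `L²` -/

theorem integrable_mul_kern (hn : 1 ≤ n) {f : Heis n → ℂ} (hf : Integrable f)
    {x : fan n × (Fin n → ℂ)} (hx : (x.1 : ℝ × ℝ).1 ≠ 0) :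
    Integrable fun p => f p * kern x.1 x.2 p := by
  refine hf.mul_bdd (c := 1) ?_ (ae_of_all _ fun p => norm_kern_le hn hx _ p)
  exact (measurable_kern.comp (measurable_prodMk_left (x := x))).aestronglyMeasurable

theorem transformL1L2_spec (hn : 1 ≤ n) {f : Lp ℂ 2 (volume : Measure (Heis n))}
    (hf : f ∈ L1L2 n) :
    (transformL1L2 f =ᵐ[specMeasure n] fun x => ∫ p, f p * kern x.1 x.2 p) ∧
      ‖transformL1L2 f‖ = ‖f‖ := by
  obtain ⟨h1, h2⟩ := memLp_transform hn (Lp.stronglyMeasurable f) hf (Lp.memLp f)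
  rw [transformL1L2, dif_pos h1]
  refine ⟨h1.coeFn_toLp.trans (transform_ae_eq _), ?_⟩
  rw [Lp.norm_toLp, h2, Lp.norm_def]

/-- The subspace `L¹ ∩ L²` of `L²`. -/
def submoduleL1L2 (n : ℕ) : Submodule ℂ (Lp ℂ 2 (volume : Measure (Heis n))) where
  carrier := L1L2 n
  add_mem' := fun {f g} hf hg => (Integrable.add hf hg).congr (Lp.coeFn_add f g).symm
  zero_mem' := (integrable_zero _ _ _).congr (Lp.coeFn_zero _ _ _).symm
  smul_mem' := fun c f hf => (Integrable.smul c hf).congr (Lp.coeFn_smul c f).symm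

theorem dense_L1L2 (n : ℕ) : Dense (L1L2 n) := by
  intro f
  rw [EMetric.mem_closure_iff]
  intro ε hε
  obtain ⟨ε', hε', hlt⟩ := exists_between hε
  obtain ⟨g, hgc, hg, hgcont, hgm⟩ := (Lp.memLp f).exists_hasCompactSupport_eLpNorm_sub_le
    (by norm_num) hε'.ne'
  refine ⟨hgm.toLp g, ?_, ?_⟩
  · exact (hgcont.integrable_of_hasCompactSupport hgc).congr hgm.coeFn_toLp.symm
  · refine lt_of_le_of_lt ?_ hlt
    rw [Lp.edist_def]
    refine le_trans (le_of_eq (eLpNorm_congr_ae ?_)) hg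
    filter_upwards [hgm.coeFn_toLp] with x hx
    simp [hx]

/-- The transform on `L¹ ∩ L²` as a linear map. -/
def transformLinear (hn : 1 ≤ n) : submoduleL1L2 n →ₗ[ℂ] Lp ℂ 2 (specMeasure n) where
  toFun f := transformL1L2 (f : Lp ℂ 2 (volume : Measure (Heis n)))
  map_add' f g := by
    apply Lp.ext
    filter_upwards [(transformL1L2_spec hn (f + g).2).1, (transformL1L2_spec hn f.2).1,
      (transformL1L2_spec hn g.2).1, Lp.coeFn_add (transformL1L2 f.1) (transformL1L2 g.1),
      ae_specMeasure_fst_ne_zero n] with x h1 h2 h3 h4 hx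
    rw [h1, h4, Pi.add_apply, h2, h3, ← integral_add (integrable_mul_kern hn f.2 hx)
      (integrable_mul_kern hn g.2 hx)]
    refine integral_congr_ae ?_
    filter_upwards [Lp.coeFn_add f.1 g.1] with p hp
    rw [Submodule.coe_add, hp, Pi.add_apply, add_mul]
  map_smul' c f := by
    apply Lp.ext
    filter_upwards [(transformL1L2_spec hn (c • f).2).1, (transformL1L2_spec hn f.2).1,
      Lp.coeFn_smul c (transformL1L2 f.1)] with x h1 h2 h4
    rw [h1, RingHom.id_apply, h4, Pi.smul_apply, h2, smul_eq_mul, ← integral_const_mul]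
    refine integral_congr_ae ?_
    filter_upwards [Lp.coeFn_smul c f.1] with p hp
    rw [Submodule.coe_smul, hp, Pi.smul_apply, smul_eq_mul, mul_assoc]

/-- `extendFrom` is only a choice of limits. The bounded linear extension from the dense subspace
provides the limits, which identifies the two and makes the transform linear and isometric. -/
theorem exists_linearIsometry_transformL2 (hn : 1 ≤ n) :
    ∃ Φ : Lp ℂ 2 (volume : Measure (Heis n)) →ₗᵢ[ℂ] Lp ℂ 2 (specMeasure n),
      (∀ f, transformL2 f = Φ f) ∧ ∀ f ∈ L1L2 n,
        Φ f =ᵐ[specMeasure n] fun x => ∫ p, f p * kern x.1 x.2 p := by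
  have hdr : DenseRange (submoduleL1L2 n).subtype := by
    have := dense_L1L2 n
    rw [DenseRange, Submodule.coe_subtype, Subtype.range_coe]
    exact this
  have hnorm : ∀ f, ‖transformLinear hn f‖ = ‖(submoduleL1L2 n).subtype f‖ := fun f =>
    (transformL1L2_spec hn f.2).2
  have hC : ∃ C, ∀ f, ‖transformLinear hn f‖ ≤ C * ‖(submoduleL1L2 n).subtype f‖ :=
    ⟨1, fun f => by rw [hnorm, one_mul]⟩
  let Ψ := (transformLinear hn).extendOfNorm (submoduleL1L2 n).subtype
  have hΨ : ∀ f ∈ L1L2 n, Ψ f = transformL1L2 f := fun f hf =>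
    LinearMap.extendOfNorm_eq hdr hC ⟨f, hf⟩
  have hiso : ∀ f, ‖Ψ f‖ = ‖f‖ := by
    intro f
    have hcl : IsClosed {f | ‖Ψ f‖ = ‖f‖} :=
      isClosed_eq (Ψ.continuous.norm) continuous_norm
    have hsub : closure (L1L2 n) ⊆ {f | ‖Ψ f‖ = ‖f‖} := by
      refine closure_minimal (fun g hg => ?_) hcl
      change ‖Ψ g‖ = ‖g‖
      rw [hΨ g hg]
      exact (transformL1L2_spec hn hg).2
    exact hsub (dense_L1L2 n f)
  refine ⟨⟨Ψ.toLinearMap, hiso⟩, fun f => ?_, fun f hf => ?_⟩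
  · refine extendFrom_eq (dense_L1L2 n f) ?_
    have h1 : Filter.Tendsto Ψ (𝓝[L1L2 n] f) (𝓝 (Ψ f)) :=
      (Ψ.continuous.tendsto f).mono_left nhdsWithin_le_nhds
    refine h1.congr' ?_
    filter_upwards [self_mem_nhdsWithin] with g hg
    exact hΨ g hg
  · change Ψ f =ᵐ[specMeasure n] _
    rw [hΨ f hf]
    exact (transformL1L2_spec hn hf).1

/-! ### Functions with support and spectrum of finite measure vanish -/

/-- On W the density c_{n,k}^{-2}|λ|^{2n} of ν₂ is at least M^{2n}, since c_{n,k} ≤ 1. This is where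
separation from λ = 0 is needed: near 0 the density degenerates. -/
theorem volume_iUnion_ray_preimage_lt_top {W : Set (fan n)} (hW : MeasurableSet W)
    (hWfin : nu₂ n W < ∞) {M : ℝ} (hM : 0 < M) (hWM : ∀ a ∈ W, M < |(a : ℝ × ℝ).1|) :
    volume (⋃ k, ray n k ⁻¹' W) < ∞ := by
  have h := lintegral_nu₂ n (measurable_one.indicator hW)
  rw [lintegral_indicator_one hW] at h
  set D : ℝ≥0∞ := ENNReal.ofReal (((2 * Real.pi) ^ (2 * n + 1))⁻¹ * M ^ (2 * n)) with hD
  have hD0 : D ≠ 0 := by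
    rw [hD]
    have : 0 < ((2 * Real.pi) ^ (2 * n + 1))⁻¹ * M ^ (2 * n) := by positivity
    simpa using this
  have hle : D * volume (⋃ k, ray n k ⁻¹' W) ≤ nu₂ n W := by
    rw [h]
    refine (mul_le_mul_right (measure_iUnion_le _) _).trans ?_
    rw [← ENNReal.tsum_mul_left]
    refine ENNReal.tsum_le_tsum fun k => ?_
    have hmk : MeasurableSet (ray n k ⁻¹' W) := measurable_ray n k hW
    have h1 : ENNReal.ofReal (M ^ (2 * n)) * volume (ray n k ⁻¹' W) ≤
        ∫⁻ l : ℝ, ENNReal.ofReal (|l| ^ (2 * n)) * W.indicator 1 (ray n k l) := by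
      rw [← lintegral_indicator_one hmk, ← lintegral_const_mul _ (measurable_one.indicator hmk)]
      refine lintegral_mono fun l => ?_
      by_cases hl : ray n k l ∈ W
      · have := hWM _ hl
        simp only [Set.indicator, Set.mem_preimage, hl, if_true, Pi.one_apply, mul_one]
        refine ENNReal.ofReal_le_ofReal (pow_le_pow_left₀ hM.le this.le _)
      · simp [Set.indicator, hl]
    rw [hD, ENNReal.ofReal_mul (by positivity), mul_assoc]
    refine mul_le_mul' (ENNReal.ofReal_le_ofReal ?_) h1
    have hc := coeff_pos n k
    have hc1 := coeff_le_one n k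
    refine le_mul_of_one_le_right (by positivity) ((one_le_inv₀ (by positivity)).mpr ?_)
    exact pow_le_one₀ hc.le hc1
  by_contra htop
  rw [not_lt_top_iff] at htop
  rw [htop, ENNReal.mul_top hD0, top_le_iff] at hle
  exact hWfin.ne hle

theorem integrable_of_ae_eq_zero {V : Set (Heis n)} (hVfin : volume V < ∞)
    {f : Heis n → ℂ} (hf2 : MemLp f 2 volume) (hfV : ∀ᵐ p, p ∉ V → f p = 0) : Integrable f := by
  have : IsFiniteMeasure (volume.restrict V) := ⟨by simpa using hVfin⟩
  have h1 : IntegrableOn f V volume := (hf2.restrict V).integrable (by norm_num)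
  exact h1.integrable_of_ae_notMem_eq_zero hfV

/-- When λ is outside the projection of W, no point (λ,(2k+n)|λ|) belongs to W, so every twisted
convolution of f^λ with φ_k vanishes and the Plancherel sum at λ forces f^λ = 0. -/
theorem ae_centralFourier_eq_zero (hn : 1 ≤ n) {f : Heis n → ℂ} (hfm : StronglyMeasurable f)
    (hf : Integrable f) (hf2 : MemLp f 2 volume) {W : Set (fan n)} (hW : MeasurableSet W)
    (hfW : ∀ᵐ x ∂(specMeasure n), x.1 ∉ W → ∫ p, f p * kern x.1 x.2 p = 0) :
    ∀ᵐ l : ℝ, (l ∉ ⋃ k, ray n k ⁻¹' W) → ∀ᵐ z, centralFourier f l z = 0 := by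
  let F : fan n × (Fin n → ℂ) → ℝ≥0∞ := (Prod.fst ⁻¹' Wᶜ).indicator fun x =>
    ‖∫ p, f p * kern x.1 x.2 p‖ₑ ^ 2
  have hF : Measurable F := ((stronglyMeasurable_integral_kern hfm).enorm.pow_const 2).indicator
    (measurable_fst hW.compl)
  have hF0 : ∫⁻ x, F x ∂(specMeasure n) = 0 := by
    rw [lintegral_eq_zero_iff hF]
    filter_upwards [hfW] with x hx
    by_cases h : x.1 ∈ W
    · simp [F, h]
    · simp [F, h, hx h]
  rw [lintegral_specMeasure n hF, lintegral_eq_zero_iff (by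
    refine Measurable.tsum fun k => Measurable.const_mul (Measurable.mul (by fun_prop)
      (hF.lintegral_prod_right'.comp (measurable_ray n k))) _)] at hF0
  have hm2 := (stronglyMeasurable_centralFourier hfm).enorm.pow_const 2
  have hfin : ∀ᵐ l : ℝ, ∫⁻ z, ‖centralFourier f l z‖ₑ ^ 2 < ∞ := by
    refine ae_lt_top hm2.lintegral_prod_right' ?_
    rw [lintegral_centralFourier hfm hf hf2, ← eLpNorm_two_sq]
    exact ENNReal.mul_ne_top ENNReal.ofReal_ne_top (ENNReal.pow_ne_top hf2.eLpNorm_ne_top)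
  have hl0 : ∀ᵐ l : ℝ, l ≠ 0 := by simp [ae_iff]
  filter_upwards [hF0, hfin, hl0] with l hl hlfin hl0 hlΛ
  have hg := integrable_centralFourier hf l
  have hg2 : MemLp (centralFourier f l) 2 volume := memLp_two_of_lintegral hg.1 hlfin
  have hl1 : 0 < |l| := abs_pos.mpr hl0
  have hk : ∀ k, ∫⁻ w, ‖twConv k l (centralFourier f l) w‖ₑ ^ 2 = 0 := by
    intro k
    have hkW : ray n k l ∉ W := fun h => hlΛ (Set.mem_iUnion.mpr ⟨k, h⟩)
    have hc := coeff_pos n k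
    have h1 := ENNReal.tsum_eq_zero.mp hl k
    have h2 : ∀ w, F (ray n k l, w) =
        ‖(coeff n k : ℂ)‖ₑ ^ 2 * ‖twConv k l (centralFourier f l) w‖ₑ ^ 2 := by
      intro w
      simp [F, hkW, integral_kern_ray hn hf k hl0, mul_pow]
    simp_rw [h2] at h1
    rw [lintegral_const_mul' _ _ (by simp), mul_eq_zero, mul_eq_zero, mul_eq_zero] at h1
    rcases h1 with h1 | h1 | h1 | h1
    · rw [ENNReal.ofReal_eq_zero, ← not_lt] at h1
      exact absurd (by positivity) h1
    · rw [ENNReal.ofReal_eq_zero, ← not_lt] at h1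
      exact absurd (by positivity) h1
    · simp [hc.ne'] at h1
    · exact h1
  have h3 := tsum_lintegral_twConv hn hl0 hg hg2
  simp_rw [hk] at h3
  rw [tsum_zero, eq_comm, mul_eq_zero] at h3
  have h4 : ∫⁻ z, ‖centralFourier f l z‖ₑ ^ 2 = 0 := by
    refine h3.resolve_left fun h => ?_
    rw [ENNReal.ofReal_eq_zero, ← not_lt] at h
    exact absurd (by positivity) h
  rw [lintegral_eq_zero_iff' (hg.1.enorm.pow_const 2)] at h4
  filter_upwards [h4] with z hz
  simpa using hz

theorem ae_eq_zero_of_support_of_spectrum (hn : 1 ≤ n) {V : Set (Heis n)} (hV : MeasurableSet V)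
    (hVfin : volume V < ∞) {W : Set (fan n)} (hW : MeasurableSet W)
    (hWfin : nu₂ n W < ∞) {M : ℝ} (hM : 0 < M) (hWM : ∀ a ∈ W, M < |(a : ℝ × ℝ).1|)
    {f : Heis n → ℂ} (hfm : StronglyMeasurable f) (hf2 : MemLp f 2 volume)
    (hfV : ∀ᵐ p, p ∉ V → f p = 0)
    (hfW : ∀ᵐ x ∂(specMeasure n), x.1 ∉ W → ∫ p, f p * kern x.1 x.2 p = 0) :
    f =ᵐ[volume] 0 := by
  have hf := integrable_of_ae_eq_zero hVfin hf2 hfV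
  set L : Set ℝ := ⋃ k, ray n k ⁻¹' W with hL
  have hLm : MeasurableSet L := MeasurableSet.iUnion fun k => measurable_ray n k hW
  have hLfin := volume_iUnion_ray_preimage_lt_top hW hWfin hM hWM
  have hpi : (2 * Real.pi) ≠ 0 := by positivity
  have h1 : ∀ᵐ l : ℝ, ∀ᵐ z, l ∉ L → centralFourier f l z = 0 := by
    filter_upwards [ae_centralFourier_eq_zero hn hfm hf hf2 hW hfW] with l hl
    by_cases h : l ∈ L
    · exact ae_of_all _ fun z h' => absurd h h'
    · filter_upwards [hl h] with z hz _
      exact hz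
  have h2 : ∀ᵐ z : Fin n → ℂ, ∀ᵐ l : ℝ, l ∉ L → centralFourier f l z = 0 := by
    refine (Measure.ae_ae_comm (p := fun (l : ℝ) (z : Fin n → ℂ) =>
      l ∉ L → centralFourier f l z = 0) ?_).mp h1
    have h3 : MeasurableSet {q : ℝ × (Fin n → ℂ) | centralFourier f q.1 q.2 = 0} :=
      (stronglyMeasurable_centralFourier hfm).measurable (measurableSet_singleton 0)
    have h4 : MeasurableSet {q : ℝ × (Fin n → ℂ) | q.1 ∈ L} := measurable_fst hLm
    convert h4.union h3 using 1
    ext q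
    simp [imp_iff_not_or]
  have hInt : ∀ᵐ z : Fin n → ℂ, Integrable fun t => f (z, t) := hf.prod_right_ae
  have hmem : ∀ᵐ z : Fin n → ℂ, ∫⁻ t, ‖f (z, t)‖ₑ ^ 2 < ∞ := by
    refine ae_lt_top (hfm.enorm.pow_const 2).lintegral_prod_right' ?_
    rw [← lintegral_prod _ (hfm.enorm.pow_const 2).aemeasurable, ← Measure.volume_eq_prod,
      ← eLpNorm_two_sq]
    exact ENNReal.pow_ne_top hf2.eLpNorm_ne_top
  have hVz : ∀ᵐ z : Fin n → ℂ, volume (Prod.mk z ⁻¹' V) < ∞ :=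
    Measure.ae_measure_lt_top hV hVfin.ne
  have hfVz : ∀ᵐ z : Fin n → ℂ, ∀ᵐ t : ℝ, (z, t) ∉ V → f (z, t) = 0 :=
    Measure.ae_ae_of_ae_prod hfV
  have hz0 : ∀ᵐ z : Fin n → ℂ, ∫⁻ t, ‖f (z, t)‖ₑ ^ 2 = 0 := by
    filter_upwards [h2, hInt, hmem, hVz, hfVz] with z hz hzi hzm hzV hzf
    -- Rescaling from λ to the frequency ξ = λ/2π used by the Fourier transform on the line.
    let s : Set ℝ := (fun ξ => 2 * Real.pi * ξ) ⁻¹' L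
    have hsm : MeasurableSet s := measurable_const_mul (2 * Real.pi) hLm
    have hsfin : volume s ≠ ∞ := by
      rw [Real.volume_preimage_mul_left hpi]
      exact ENNReal.mul_ne_top ENNReal.ofReal_ne_top hLfin.ne
    have hq : Measure.QuasiMeasurePreserving (fun ξ : ℝ => 2 * Real.pi * ξ) volume volume :=
      ⟨measurable_const_mul _, by
        rw [Real.map_volume_mul_left hpi]
        exact Measure.smul_absolutelyContinuous⟩
    have h0 := ae_eq_zero_of_support_finite hzi (memLp_two_of_lintegral hzi.1 hzm)
      (measurable_prodMk_left hV) hzV.ne hzf hsm hsfin (by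
        filter_upwards [hq.ae hz] with ξ hξ hξs
        have := hξ hξs
        rwa [centralFourier_eq_fourier, ← mul_assoc, inv_mul_cancel₀ hpi, one_mul] at this)
    rw [← lintegral_zero (μ := (volume : Measure ℝ))]
    refine lintegral_congr_ae ?_
    filter_upwards [h0] with t ht
    rw [ht]
    simp
  have hfin : ∫⁻ p, ‖f p‖ₑ ^ 2 = 0 := by
    rw [Measure.volume_eq_prod, lintegral_prod _ (hfm.enorm.pow_const 2).aemeasurable,
      lintegral_congr_ae hz0, lintegral_zero]
  rw [lintegral_eq_zero_iff (hfm.enorm.pow_const 2)] at hfin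
  filter_upwards [hfin] with p hp
  simpa using hp

/-! ### Compactness and the uncertainty inequality -/

theorem exists_bound_of_seqCompact {E F : Type*} [NormedAddCommGroup E] [NormedSpace ℂ E]
    [NormedAddCommGroup F] [NormedSpace ℂ F] (R : E →L[ℂ] F) (hR : ∀ f, R f = 0 → f = 0)
    (hc : ∀ u : ℕ → E, (∀ j, ‖u j‖ ≤ 1) → Filter.Tendsto (fun j => R (u j)) Filter.atTop (𝓝 0) →
      ∃ φ : ℕ → ℕ, StrictMono φ ∧ ∃ g, Filter.Tendsto (u ∘ φ) Filter.atTop (𝓝 g)) :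
    ∃ C : ℝ, 0 < C ∧ ∀ f, ‖f‖ ≤ C * ‖R f‖ := by
  by_contra! h
  choose f hf using fun j : ℕ => h ((j : ℝ) + 1) (by positivity)
  have hf0 : ∀ j, 0 < ‖f j‖ := fun j => lt_of_le_of_lt (by positivity) (hf j)
  let u : ℕ → E := fun j => ((‖f j‖⁻¹ : ℝ) : ℂ) • f j
  have hu : ∀ j, ‖u j‖ = 1 := fun j => by
    simp [u, norm_smul, inv_mul_cancel₀ (hf0 j).ne']
  have hRu : ∀ j, ‖R (u j)‖ ≤ 1 / ((j : ℝ) + 1) := fun j => by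
    have h1 : ‖R (u j)‖ = ‖R (f j)‖ / ‖f j‖ := by
      simp [u, norm_smul, div_eq_inv_mul]
    rw [h1, div_le_div_iff₀ (hf0 j) (by positivity)]
    linarith [hf j]
  have hlim : Filter.Tendsto (fun j => R (u j)) Filter.atTop (𝓝 0) :=
    squeeze_zero_norm hRu tendsto_one_div_add_atTop_nhds_zero_nat
  obtain ⟨φ, hφ, g, hg⟩ := hc u (fun j => (hu j).le) hlim
  have hRg : R g = 0 :=
    tendsto_nhds_unique ((R.continuous.tendsto g).comp hg) (hlim.comp hφ.tendsto_atTop)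
  have hg1 : ‖g‖ = 1 := by
    refine tendsto_nhds_unique hg.norm ?_
    simp [hu]
  rw [hR g hRg, norm_zero] at hg1
  exact zero_ne_one hg1

/-- Sequential Banach–Alaoglu in the dual, carried back by the Riesz isomorphism; this isomorphism
is conjugate linear, hence the conjugations. -/
theorem exists_subseq_tendsto_inner {H : Type*} [NormedAddCommGroup H] [InnerProductSpace ℂ H]
    [CompleteSpace H] [TopologicalSpace.SeparableSpace H] {u : ℕ → H} (hu : ∀ j, ‖u j‖ ≤ 1) :
    ∃ φ : ℕ → ℕ, StrictMono φ ∧ ∃ v : H, ∀ x,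
      Filter.Tendsto (fun j => inner ℂ x (u (φ j))) Filter.atTop (𝓝 (inner ℂ x v)) := by
  obtain ⟨a, -, φ, hφ, ha⟩ := WeakDual.isSeqCompact_closedBall ℂ H (0 : StrongDual ℂ H) 1
    (x := fun j => StrongDual.toWeakDual (InnerProductSpace.toDual ℂ H (u j)))
    (fun j => by simpa using hu j)
  refine ⟨φ, hφ, (InnerProductSpace.toDual ℂ H).symm (WeakDual.toStrongDual a), fun x => ?_⟩
  have h1 := ((WeakDual.eval_continuous x).tendsto a).comp ha
  have h2 := (Complex.continuous_conj.tendsto _).comp h1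
  rw [← inner_conj_symm x, InnerProductSpace.toDual_symm_apply]
  refine h2.congr fun j => ?_
  rw [← inner_conj_symm x]
  rfl

/-- An operator given by pairing with uniformly bounded vectors `K y` over a finite measure space is
compact: weak convergence of the arguments gives pointwise convergence of the values, and constants
dominate. -/
theorem exists_subseq_tendsto_of_inner {H Y : Type*} [NormedAddCommGroup H]
    [InnerProductSpace ℂ H] [CompleteSpace H] [TopologicalSpace.SeparableSpace H]
    [MeasurableSpace Y] {ν : Measure Y} [IsFiniteMeasure ν] (T : H → Lp ℂ 2 ν) {K : Y → H} {C : ℝ}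
    (hK : ∀ᵐ y ∂ν, ‖K y‖ ≤ C) (hT : ∀ h, T h =ᵐ[ν] fun y => inner ℂ (K y) h)
    {u : ℕ → H} (hu : ∀ j, ‖u j‖ ≤ 1) :
    ∃ φ : ℕ → ℕ, StrictMono φ ∧ ∃ v, Filter.Tendsto (fun j => T (u (φ j))) Filter.atTop (𝓝 v) := by
  obtain ⟨φ, hφ, v, hv⟩ := exists_subseq_tendsto_inner hu
  refine ⟨φ, hφ, T v, ?_⟩
  rw [Lp.tendsto_Lp_iff_tendsto_eLpNorm']
  have h0 : Filter.Tendsto (fun j => ∫⁻ y, ‖(T (u (φ j)) - T v : Y → ℂ) y‖ₑ ^ 2 ∂ν)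
      Filter.atTop (𝓝 0) := by
    rw [← lintegral_zero (μ := ν)]
    refine tendsto_lintegral_of_dominated_convergence'
      (fun _ => ENNReal.ofReal (C * (1 + ‖v‖)) ^ 2) (fun j => ?_) (fun j => ?_) ?_ ?_
    · exact ((Lp.aestronglyMeasurable _).sub (Lp.aestronglyMeasurable _)).enorm.pow_const 2
    · filter_upwards [hK, hT (u (φ j)), hT v] with y hy h1 h2
      rw [Pi.sub_apply, h1, h2, ← inner_sub_right, ← ofReal_norm]
      gcongr
      refine (norm_inner_le_norm _ _).trans ?_
      have := norm_sub_le (u (φ j)) v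
      have := hu (φ j)
      gcongr
      · exact (norm_nonneg _).trans hy
      · linarith
    · rw [lintegral_const]
      exact ENNReal.mul_ne_top (by simp) (measure_ne_top _ _)
    · filter_upwards [ae_all_iff.mpr fun j => hT (u (φ j)), hT v] with y h1 h2
      have h3 := ((hv (K y)).sub_const (inner ℂ (K y) v)).enorm
      rw [sub_self, enorm_zero] at h3
      have h4 := ((ENNReal.continuous_pow 2).tendsto 0).comp h3
      simp only [Pi.sub_apply, h1, h2]
      simpa [Function.comp_def] using h4
  have h1 := ((ENNReal.continuous_rpow_const (y := (1 / 2 : ℝ))).tendsto 0).comp h0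
  rw [ENNReal.zero_rpow_of_pos (by norm_num)] at h1
  refine h1.congr fun j => ?_
  simp only [Function.comp]
  rw [← eLpNorm_two_sq, ← ENNReal.rpow_natCast, ← ENNReal.rpow_mul]
  norm_num

theorem norm_Lp_restrict {α : Type*} [MeasurableSpace α] {μ : Measure α} (s : Set α)
    (f : Lp ℂ 2 μ) :
    ‖LpToLpRestrictCLM α ℂ ℂ μ 2 s f‖ = (eLpNorm f 2 (μ.restrict s)).toReal := by
  rw [Lp.norm_def, eLpNorm_congr_ae (LpToLpRestrictCLM_coeFn ℂ s f)]

theorem norm_Lp_restrict_le {α : Type*} [MeasurableSpace α] {μ : Measure α} (s : Set α)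
    (f : Lp ℂ 2 μ) : ‖LpToLpRestrictCLM α ℂ ℂ μ 2 s f‖ ≤ ‖f‖ := by
  rw [norm_Lp_restrict, Lp.norm_def]
  exact ENNReal.toReal_mono (Lp.eLpNorm_ne_top f) (eLpNorm_mono_measure _ Measure.restrict_le_self)

theorem norm_le_restrict_add_compl {α : Type*} [MeasurableSpace α] {μ : Measure α} {s : Set α}
    (hs : MeasurableSet s) (f : Lp ℂ 2 μ) :
    ‖f‖ ≤ ‖LpToLpRestrictCLM α ℂ ℂ μ 2 s f‖ + ‖LpToLpRestrictCLM α ℂ ℂ μ 2 sᶜ f‖ := by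
  have hfin : ∀ t : Set α, eLpNorm f 2 (μ.restrict t) ≠ ∞ := fun t =>
    ((Lp.memLp f).restrict t).eLpNorm_ne_top
  rw [norm_Lp_restrict, norm_Lp_restrict, Lp.norm_def, ← ENNReal.toReal_add (hfin _) (hfin _)]
  refine ENNReal.toReal_mono (ENNReal.add_ne_top.mpr ⟨hfin _, hfin _⟩) ?_
  rw [← eLpNorm_indicator_eq_eLpNorm_restrict hs,
    ← eLpNorm_indicator_eq_eLpNorm_restrict hs.compl]
  conv_lhs => rw [← Set.indicator_self_add_compl s f]
  exact eLpNorm_add_le ((Lp.aestronglyMeasurable f).indicator hs)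
    ((Lp.aestronglyMeasurable f).indicator hs.compl) (by norm_num)

theorem restrict_eq_zero_iff {α : Type*} [MeasurableSpace α] {μ : Measure α} {s : Set α}
    (hs : MeasurableSet s) (f : Lp ℂ 2 μ) :
    LpToLpRestrictCLM α ℂ ℂ μ 2 s f = 0 ↔ ∀ᵐ x ∂μ, x ∈ s → f x = 0 := by
  rw [← ae_restrict_iff' hs, Lp.eq_zero_iff_ae_eq_zero]
  exact ⟨fun h => (LpToLpRestrictCLM_coeFn ℂ s f).symm.trans h,
    fun h => (LpToLpRestrictCLM_coeFn ℂ s f).trans h⟩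

/-- The truncation `1_V f` of a square integrable function. -/
def truncate {V : Set (Heis n)} (hV : MeasurableSet V)
    (f : Lp ℂ 2 (volume : Measure (Heis n))) : Lp ℂ 2 (volume : Measure (Heis n)) :=
  ((Lp.memLp f).indicator hV).toLp

theorem norm_sub_truncate {V : Set (Heis n)} (hV : MeasurableSet V)
    (f : Lp ℂ 2 (volume : Measure (Heis n))) :
    ‖f - truncate hV f‖ = ‖LpToLpRestrictCLM (Heis n) ℂ ℂ volume 2 Vᶜ f‖ := by
  rw [norm_Lp_restrict, Lp.norm_def, ← eLpNorm_indicator_eq_eLpNorm_restrict hV.compl]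
  congr 1
  refine eLpNorm_congr_ae ?_
  filter_upwards [Lp.coeFn_sub f (truncate hV f), ((Lp.memLp f).indicator hV).coeFn_toLp]
    with p h1 h2
  rw [h1, Pi.sub_apply, truncate, h2]
  by_cases hp : p ∈ V <;> simp [hp]

theorem truncate_mem_L1L2 {V : Set (Heis n)} (hV : MeasurableSet V) (hVfin : volume V < ∞)
    (f : Lp ℂ 2 (volume : Measure (Heis n))) : truncate hV f ∈ L1L2 n := by
  refine integrable_of_ae_eq_zero hVfin (Lp.memLp _) ?_
  filter_upwards [((Lp.memLp f).indicator hV).coeFn_toLp] with p h hp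
  rw [truncate, h]
  simp [hp]

theorem measurable_kern_right (a : fan n) (w : Fin n → ℂ) : Measurable (kern a w) := by
  have := (measurable_kern (n := n)).comp (measurable_prodMk_left (x := (a, w)))
  simpa only [Function.comp_def] using this

/-- The Riesz representative of f ↦ 𝓕(1_V f)(a,w) is the conjugate kernel cut off to V; its norm is
at most |V|^{1/2} because the kernel is bounded by 1. -/
theorem exists_truncated_kern (hn : 1 ≤ n) {V : Set (Heis n)} (hV : MeasurableSet V)
    (hVfin : volume V < ∞) {a : fan n} (ha : (a : ℝ × ℝ).1 ≠ 0) (w : Fin n → ℂ) :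
    ∃ K : Lp ℂ 2 (volume : Measure (Heis n)), ‖K‖ ≤ ((volume V) ^ (1 / 2 : ℝ)).toReal ∧
      ∀ f, inner ℂ K f = ∫ p, truncate hV f p * kern a w p := by
  obtain ⟨k, hkdef⟩ : ∃ k : Heis n → ℂ, k = V.indicator fun p => (starRingEnd ℂ) (kern a w p) :=
    ⟨_, rfl⟩
  have hkm : Measurable k := by
    rw [hkdef]
    exact (Complex.continuous_conj.measurable.comp (measurable_kern_right a w)).indicator hV
  have hk : ∀ p, ‖k p‖ ≤ ‖V.indicator (fun _ => (1 : ℝ)) p‖ := fun p => by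
    by_cases hp : p ∈ V <;> simp [hkdef, hp, norm_kern_le hn ha w p]
  have h1 : MemLp (V.indicator fun _ => (1 : ℝ)) 2 (volume : Measure (Heis n)) :=
    memLp_indicator_const 2 hV 1 (Or.inr hVfin.ne)
  have hkL : MemLp k 2 (volume : Measure (Heis n)) :=
    h1.mono hkm.aestronglyMeasurable (ae_of_all _ hk)
  refine ⟨hkL.toLp, ?_, fun f => ?_⟩
  · rw [Lp.norm_toLp]
    refine ENNReal.toReal_mono (ENNReal.rpow_ne_top_of_nonneg (by norm_num) hVfin.ne) ?_
    refine (eLpNorm_mono hk).trans ?_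
    rw [eLpNorm_indicator_const hV (by norm_num) (by norm_num)]
    simp
  · rw [L2.inner_def]
    refine integral_congr_ae ?_
    filter_upwards [hkL.coeFn_toLp, ((Lp.memLp f).indicator hV).coeFn_toLp] with p h2 h3
    rw [h2, truncate, h3]
    by_cases hp : p ∈ V <;> simp [hkdef, hp, RCLike.inner_apply]

/-- The uncertainty inequality for measurable sets, in terms of restriction operators. -/
theorem exists_norm_le_restrict (hn : 1 ≤ n) {V : Set (Heis n)} (hV : MeasurableSet V)
    (hVfin : volume V < ∞) {W : Set (fan n)} (hW : MeasurableSet W) (hWfin : nu₂ n W < ∞)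
    {M : ℝ} (hM : 0 < M) (hWM : ∀ a ∈ W, M < |(a : ℝ × ℝ).1|)
    {B : Set (Fin n → ℂ)} (hB : MeasurableSet B) (hBfin : volume B < ∞) :
    ∃ C : ℝ, 0 < C ∧ ∀ f : Lp ℂ 2 (volume : Measure (Heis n)),
      ‖f‖ ≤ C * max ‖LpToLpRestrictCLM (Heis n) ℂ ℂ volume 2 Vᶜ f‖
        ‖LpToLpRestrictCLM _ ℂ ℂ (specMeasure n) 2 (W ×ˢ B)ᶜ (transformL2 f)‖ := by
  obtain ⟨Φ, hΦ, hΦ1⟩ := exists_linearIsometry_transformL2 (n := n) hn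
  have hWB : MeasurableSet (W ×ˢ B) := hW.prod hB
  let R₁ := LpToLpRestrictCLM (Heis n) ℂ ℂ volume 2 Vᶜ
  let R₂ := (LpToLpRestrictCLM _ ℂ ℂ (specMeasure n) 2 (W ×ˢ B)ᶜ).comp Φ.toContinuousLinearMap
  let R₃ := (LpToLpRestrictCLM _ ℂ ℂ (specMeasure n) 2 (W ×ˢ B)).comp Φ.toContinuousLinearMap
  have hiso : ∀ f, ‖f‖ ≤ ‖R₃ f‖ + ‖R₂ f‖ := fun f => by
    rw [← Φ.norm_map f]
    exact norm_le_restrict_add_compl hWB (Φ f)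
  have hfinWB : IsFiniteMeasure ((specMeasure n).restrict (W ×ˢ B)) := ⟨by
    rw [Measure.restrict_apply_univ, Measure.prod_prod]
    exact ENNReal.mul_lt_top hWfin hBfin⟩
  -- The product of normed spaces carries the sup norm, which accounts for the maximum in the
  -- statement.
  suffices h : ∃ C : ℝ, 0 < C ∧ ∀ f, ‖f‖ ≤ C * ‖R₁.prod R₂ f‖ by
    obtain ⟨C, hC, h⟩ := h
    refine ⟨C, hC, fun f => ?_⟩
    rw [hΦ]
    exact h f
  refine exists_bound_of_seqCompact _ (fun f hf => ?_) fun u hu hRu => ?_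
  · have hf1 : R₁ f = 0 := congrArg Prod.fst hf
    have hf2 : R₂ f = 0 := congrArg Prod.snd hf
    have hV0 := (restrict_eq_zero_iff hV.compl f).mp hf1
    have hW0 := (restrict_eq_zero_iff hWB.compl (Φ f)).mp hf2
    rw [Lp.eq_zero_iff_ae_eq_zero]
    refine ae_eq_zero_of_support_of_spectrum hn hV hVfin hW hWfin hM hWM
      (Lp.stronglyMeasurable f) (Lp.memLp f) hV0 ?_
    filter_upwards [hW0, hΦ1 f (integrable_of_ae_eq_zero hVfin (Lp.memLp f) hV0)] with x h1 h2 hx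
    rw [← h2]
    exact h1 fun h => hx h.1
  · have hR1 : Filter.Tendsto (fun j => R₁ (u j)) Filter.atTop (𝓝 0) :=
      (continuous_fst.tendsto _).comp hRu
    have hR2 : Filter.Tendsto (fun j => R₂ (u j)) Filter.atTop (𝓝 0) :=
      (continuous_snd.tendsto _).comp hRu
    have hex : ∀ x : fan n × (Fin n → ℂ), ∃ K : Lp ℂ 2 (volume : Measure (Heis n)),
        (x.1 : ℝ × ℝ).1 ≠ 0 → ‖K‖ ≤ ((volume V) ^ (1 / 2 : ℝ)).toReal ∧
          ∀ f, inner ℂ K f = ∫ p, truncate hV f p * kern x.1 x.2 p := fun x => by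
      by_cases hx : (x.1 : ℝ × ℝ).1 = 0
      · exact ⟨0, fun h => absurd hx h⟩
      · obtain ⟨K, hK⟩ := exists_truncated_kern hn hV hVfin hx x.2
        exact ⟨K, fun _ => hK⟩
    choose K hK using hex
    have hne := ae_restrict_of_ae (s := W ×ˢ B) (ae_specMeasure_fst_ne_zero n)
    have : Fact ((2 : ℝ≥0∞) ≠ ∞) := ⟨by norm_num⟩
    obtain ⟨φ, hφ, v, hv⟩ := exists_subseq_tendsto_of_inner (fun f => R₃ (truncate hV f))
      (K := K) (C := ((volume V) ^ (1 / 2 : ℝ)).toReal)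
      (by filter_upwards [hne] with x hx using (hK x hx).1)
      (fun f => by
        refine (LpToLpRestrictCLM_coeFn ℂ (W ×ˢ B) (Φ (truncate hV f))).trans ?_
        filter_upwards [hne, ae_restrict_of_ae (hΦ1 _ (truncate_mem_L1L2 hV hVfin f))]
          with x hx h
        rw [h, (hK x hx).2]) hu
    -- The part of `u (φ j)` outside V is negligible: its norm is that of `R₁ (u (φ j))`. Hence `R₃
    -- (u (φ j))` inherits convergence from the truncated sequence, and with `R₂` it controls the
    -- whole norm.
    have h0 : Filter.Tendsto (fun j => R₃ (u (φ j) - truncate hV (u (φ j)))) Filter.atTop (𝓝 0) :=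
        by
      refine squeeze_zero_norm (a := fun j => ‖R₁ (u (φ j))‖) (fun j => ?_) ?_
      · refine (norm_Lp_restrict_le _ _).trans (le_of_eq ?_)
        exact (Φ.norm_map _).trans (norm_sub_truncate hV _)
      · simpa using (hR1.comp hφ.tendsto_atTop).norm
    have h3 : CauchySeq fun j => R₃ (u (φ j)) := by
      refine Filter.Tendsto.cauchySeq (x := v) ?_
      simpa using hv.add h0
    have h2 : CauchySeq fun j => R₂ (u (φ j)) := (hR2.comp hφ.tendsto_atTop).cauchySeq
    refine ⟨φ, hφ, cauchySeq_tendsto_of_complete ?_⟩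
    rw [Metric.cauchySeq_iff] at h2 h3 ⊢
    intro ε hε
    obtain ⟨N₂, hN₂⟩ := h2 (ε / 2) (half_pos hε)
    obtain ⟨N₃, hN₃⟩ := h3 (ε / 2) (half_pos hε)
    refine ⟨max N₂ N₃, fun i hi j hj => ?_⟩
    have e2 := hN₂ i ((le_max_left _ _).trans hi) j ((le_max_left _ _).trans hj)
    have e3 := hN₃ i ((le_max_right _ _).trans hi) j ((le_max_right _ _).trans hj)
    rw [dist_eq_norm, ← map_sub] at e2 e3
    rw [dist_eq_norm]
    exact (hiso _).trans_lt (by simpa using add_lt_add e3 e2)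

theorem exists_eLpNorm_sq_le (hn : 1 ≤ n) {V : Set (Heis n)} (hV : MeasurableSet V)
    (hVfin : volume V < ∞) {W : Set (fan n)} (hW : MeasurableSet W) (hWfin : nu₂ n W < ∞)
    {M : ℝ} (hM : 0 < M) (hWM : ∀ a ∈ W, M < |(a : ℝ × ℝ).1|)
    {B : Set (Fin n → ℂ)} (hB : MeasurableSet B) (hBfin : volume B < ∞) :
    ∃ C : ℝ≥0, 0 < C ∧ ∀ f : Lp ℂ 2 (volume : Measure (Heis n)),
      eLpNorm f 2 volume ^ 2 ≤ (C : ℝ≥0∞) * (eLpNorm f 2 (volume.restrict Vᶜ) ^ 2 +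
        eLpNorm (transformL2 f) 2 ((specMeasure n).restrict (W ×ˢ B)ᶜ) ^ 2) := by
  obtain ⟨C, hC, h⟩ := exists_norm_le_restrict hn hV hVfin hW hWfin hM hWM hB hBfin
  refine ⟨(C ^ 2).toNNReal, by simpa using pow_pos hC 2, fun f => ?_⟩
  have hf := h f
  rw [norm_Lp_restrict, norm_Lp_restrict, Lp.norm_def] at hf
  have h0 := Lp.eLpNorm_ne_top f
  have h1 := ((Lp.memLp f).restrict Vᶜ).eLpNorm_ne_top
  have h2 := ((Lp.memLp (transformL2 f)).restrict (W ×ˢ B)ᶜ).eLpNorm_ne_top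
  generalize eLpNorm f 2 volume = x at *
  generalize eLpNorm f 2 (volume.restrict Vᶜ) = y at *
  generalize eLpNorm (transformL2 f) 2 ((specMeasure n).restrict (W ×ˢ B)ᶜ) = z at *
  lift x to ℝ≥0 using h0
  lift y to ℝ≥0 using h1
  lift z to ℝ≥0 using h2
  norm_cast
  rw [← NNReal.coe_le_coe]
  push_cast
  rw [Real.coe_toNNReal _ (sq_nonneg C)]
  simp only [ENNReal.coe_toReal] at hf
  calc (x : ℝ) ^ 2 ≤ (C * max (y : ℝ) z) ^ 2 := by gcongr
    _ = C ^ 2 * (max (y : ℝ) z) ^ 2 := by ring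
    _ ≤ C ^ 2 * ((y : ℝ) ^ 2 + (z : ℝ) ^ 2) := by
      gcongr
      rcases max_cases (y : ℝ) z with h | h <;> rw [h.1] <;> nlinarith [sq_nonneg (y : ℝ),
          sq_nonneg (z : ℝ)]

end Strichartz

end

/-! ### Passage from measurable to null measurable sets -/

theorem mainTheorem2 (n : ℕ) (hn : 1 ≤ n)
    (V : Set (Strichartz.Heis n)) (hV : NullMeasurableSet V volume) (hVfin : volume V < ∞)
    (W : Set (Strichartz.fan n)) (hW : NullMeasurableSet W (Strichartz.nu₂ n))
    (hWfin : Strichartz.nu₂ n W < ∞)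
    (M : ℝ) (hM : 0 < M)
    (hWM : W ⊆ {a | ∃ k : ℕ, ∃ l : ℝ, M < |l| ∧ (a : ℝ × ℝ) = (l, (2 * (k : ℝ) + n) * |l|)})
    (B : Set (Fin n → ℂ)) (hB : NullMeasurableSet B volume) (hBfin : volume B < ∞) :
    ∃ C : ℝ≥0, 0 < C ∧ ∀ f : Lp ℂ 2 (volume : Measure (Strichartz.Heis n)),
      eLpNorm f 2 volume ^ 2 ≤
        (C : ℝ≥0∞) * (eLpNorm f 2 (volume.restrict Vᶜ) ^ 2 +
          eLpNorm (Strichartz.transformL2 f) 2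
            ((Strichartz.specMeasure n).restrict (W ×ˢ B)ᶜ) ^ 2) := by
  -- Replacing V, W, B by measurable hulls of the same measure shrinks the complements, hence the
  -- right-hand side, so the inequality for the hulls is the stronger one. The hull of W may reach
  -- small |λ| and is therefore cut back to |λ| > M, which still contains W.
  obtain ⟨C, hC, h⟩ := Strichartz.exists_eLpNorm_sq_le hn
    (measurableSet_toMeasurable volume V) (by rwa [measure_toMeasurable])
    (W := toMeasurable (Strichartz.nu₂ n) W ∩ {a | M < |(a : ℝ × ℝ).1|})
    ((measurableSet_toMeasurable _ W).inter
      (measurableSet_lt measurable_const (measurable_subtype_coe.fst.abs)))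
    ((measure_mono Set.inter_subset_left).trans_lt (by rwa [measure_toMeasurable]))
    hM (fun a ha => ha.2)
    (measurableSet_toMeasurable volume B) (by rwa [measure_toMeasurable])
  have hW' : W ⊆ toMeasurable (Strichartz.nu₂ n) W ∩ {a | M < |(a : ℝ × ℝ).1|} := fun a ha => by
    obtain ⟨k, l, hl, hal⟩ := hWM ha
    refine ⟨subset_toMeasurable _ _ ha, ?_⟩
    rw [Set.mem_ofPred_eq, hal]
    exact hl
  refine ⟨C, hC, fun f => (h f).trans ?_⟩
  gcongr
  · exact subset_toMeasurable _ _
  · exact subset_toMeasurable _ _
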